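/- Let $\alpha>0$ and let $(m_k)_{k\ge 0}$ be real numbers. For $k\ge 0$ let $\Gamma_k$ be the set of integer strings $\gamma=(j_1,\dots,j_{k+1})$ with $j_1=j_{k+1}$, $\max_u j_u=0$ and $|j_u-j_{u+1}|=1$ for $1\le u\le k$; let $l_i(\gamma)$ be the number of times $\gamma$ crosses the line $y=i+\tfrac12$. Put $L_k=0$ for $k$ odd and $$L_k=\frac1{\alpha k+1}\sum_{\gamma\in\Gamma_k}\prod_{i<0}m_{l_i(\gamma)}\qquad (k\text{ even}).$$ (1) Assume that there is a bounded random variable $Y$, with law $\mu$, such that $\mathbb E[Y^{2k}]=m_{2k}$ for all $k\ge 0$. Let $P=\mu^{\otimes\mathbb Z}$ be the law on $\mathbb R^{\mathbb Z}$ of an i.i.d. sequence with common law $\mu$, and let $H=\ell^2(\mathbb Z;L^2(P))$ (complex scalars). Then $$(\mathbf A\mathbf x)_j(\omega)=\omega_j\,x_{j-1}(\omega)+\omega_{j+1}\,x_{j+1}(\omega)\qquad (j\in\mathbb Z)$$ defines a bounded self-adjoint operator $\mathbf A$ on $H$ (a random Jacobi operator). Let $\varpi$ be its spectral measure at the vector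 $\mathbf e$ whose component at $0$ is the constant $1$ and whose other components are $0$. There are independent random variables $T$, uniform on $[0,1]$, and $W$, with law $\varpi$, such that $Z=T^{\alpha}W$ is a bounded random variable with $\mathbb E[Z^k]=L_k$ for all $k\ge 0$; the law of $Z$ is the only measure on $\mathbb R$ with these moments. This law has the form $$\nu(dx)=\tau f(x)\,dx+(1-\tau)\,\delta_0(dx),$$ where $0\le\tau\le 1$ and $f$ is a measurable probability density. (2) Let $0\le\theta\le 1$, and assume $m_0=1$ and $m_{2k}=\theta$ for all $k\ge 1$. Then the one and only measure on $\mathbb R$ with moments $L_k$, $k\ge 0$, is $$\nu_{\theta,\alpha}(dx)=\begin{cases}\delta_0(dx)&\theta=0,\\ h_\alpha(x)\,dx&\theta=1,\\ \frac{2\theta}{1+\theta}f_{\theta,\alpha}(x)\,dx+\frac{1-\theta}{1+\theta}\,\delta_0(dx)&0<\theta<1,\end{cases}$$ where $h_\alpha$ is the density of Ullman's distribution, $$h_\alpha(x)=\mathbf 1_{[-2,2]}(x)\,\frac1{\alpha\pi}\int_{|x|/2}^{1}\frac{t^{-1+1/\alpha}}{\sqrt{4t^2-x^2}}\,dt,$$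 and $$f_{\theta,\alpha}(x)=\mathbf 1_{(-2,2)}(x)\,\frac{(1+\theta)(1-\theta)^2}{2}\sum_{N\ge 1}\theta^{N-1}g_{N+2}(x),\qquad g_M(x)=|x|^{1/\alpha-1}\sum_{u=1}^{\lfloor M\arccos(|x|/2)/\pi\rfloor}\frac1{\alpha\,2^{1/\alpha}\,|\cos(u\pi/M)|^{1/\alpha}}\quad(M\ge 3),$$ with $\sum_{1}^{0}=0$. Here $h_\alpha$ and, for $0<\theta<1$, $f_{\theta,\alpha}$ are probability densities (their formulas being understood for almost every $x$), and the series defining $f_{\theta,\alpha}(x)$ converges for every $x\in(-2,2)$, $x\ne 0$. -/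

import Mathlib

open MeasureTheory ProbabilityTheory
open scoped ENNReal

noncomputable section

namespace TridiagonalMoments

/-! ### Closed paths and the numbers `L k` -/

/-- The closed paths `(j_1, …, j_{k+1})` of integers with steps `±1` and maximum `0`.
Such a path stays in `[-k, 0]`, which makes the set visibly finite; see `mem_levelPaths`. -/
def levelPaths (k : ℕ) : Finset (Fin (k + 1) → ℤ) :=
  (Fintype.piFinset fun _ : Fin (k + 1) => Finset.Icc (-(k : ℤ)) 0).filter fun γ =>
    γ 0 = γ (Fin.last k) ∧ (∃ u, γ u = 0) ∧ ∀ u : Fin k, |γ u.castSucc - γ u.succ| = 1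

theorem mem_levelPaths {k : ℕ} {γ : Fin (k + 1) → ℤ} :
    γ ∈ levelPaths k ↔ γ 0 = γ (Fin.last k) ∧ ((∀ u, γ u ≤ 0) ∧ ∃ u, γ u = 0) ∧
      ∀ u : Fin k, |γ u.castSucc - γ u.succ| = 1 := by
  simp only [levelPaths, Finset.mem_filter, Fintype.mem_piFinset, Finset.mem_Icc]
  constructor
  · rintro ⟨h, h0, h1, h2⟩
    exact ⟨h0, ⟨fun u => (h u).2, h1⟩, h2⟩
  · rintro ⟨h0, ⟨h, v, hv⟩, h2⟩
    refine ⟨fun u => ⟨?_, h u⟩, h0, ⟨v, hv⟩, h2⟩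
    have key : ∀ n : ℕ, ∀ hn : n < k + 1, |γ ⟨n, hn⟩ - γ 0| ≤ n := by
      intro n
      induction n with
      | zero => intro hn; simp
      | succ n ih =>
        intro hn
        have h3 := h2 ⟨n, by omega⟩
        have h4 := ih (by omega)
        simp only [Fin.castSucc_mk, Fin.succ_mk] at h3
        have h5 := abs_sub_le (γ ⟨n + 1, hn⟩) (γ ⟨n, by omega⟩) (γ 0)
        rw [abs_sub_comm] at h3
        push_cast
        linarith
    have key' : ∀ n : ℕ, ∀ hn : n < k + 1, |γ (Fin.last k) - γ ⟨n, hn⟩| ≤ (k : ℤ) - n := by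
      intro n hn
      have : ∀ d : ℕ, ∀ hd : n + d < k + 1, |γ ⟨n + d, hd⟩ - γ ⟨n, hn⟩| ≤ d := by
        intro d
        induction d with
        | zero => intro hd; simp
        | succ d ih =>
          intro hd
          have h3 := h2 ⟨n + d, by omega⟩
          have h4 := ih (by omega)
          simp only [Fin.castSucc_mk, Fin.succ_mk] at h3
          have h5 := abs_sub_le (γ ⟨n + d + 1, hd⟩) (γ ⟨n + d, by omega⟩) (γ ⟨n, hn⟩)
          rw [abs_sub_comm] at h3
          have h6 : γ ⟨n + (d + 1), hd⟩ = γ ⟨n + d + 1, hd⟩ := rfl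
          rw [h6]
          push_cast
          linarith
      have h7 := this (k - n) (by omega)
      have h8 : (⟨n + (k - n), by omega⟩ : Fin (k + 1)) = Fin.last k := by
        ext; simp; omega
      rw [h8] at h7
      have h9 : ((k - n : ℕ) : ℤ) = (k : ℤ) - n := by omega
      rw [h9] at h7
      exact h7
    obtain ⟨u, hu⟩ := u
    obtain ⟨v, hv'⟩ := v
    have a1 := abs_le.mp (key u hu)
    have a2 := abs_le.mp (key v hv')
    have a3 := abs_le.mp (key' u hu)
    have a4 := abs_le.mp (key' v hv')
    omega

/-- The number of times the path `γ` crosses the line `y = i + 1/2`. -/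
def crossings {k : ℕ} (γ : Fin (k + 1) → ℤ) (i : ℤ) : ℕ :=
  (Finset.univ.filter fun u : Fin k =>
    (γ u.castSucc = i ∧ γ u.succ = i + 1) ∨ (γ u.castSucc = i + 1 ∧ γ u.succ = i)).card

/-- `L k = (α k + 1)⁻¹ ∑_γ ∏_{i < 0} m (crossings γ i)` for even `k`, and `0` for odd `k`.
The product is cut at `-k`, since no path crosses a lower level and `m 0 = 1`. -/
def L (α : ℝ) (m : ℕ → ℝ) (k : ℕ) : ℝ :=
  if Even k then
    1 / (α * k + 1) * ∑ γ ∈ levelPaths k, ∏ i ∈ Finset.Ico (-(k : ℤ)) 0, m (crossings γ i)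
  else 0

/-! ### Moments, boundedness, densities -/

/-- All moments of `ν` exist, and the `k`-th one is `M k` for every `k ≥ 0`. -/
def HasMoments (ν : Measure ℝ) (M : ℕ → ℝ) : Prop :=
  ∀ k : ℕ, Integrable (fun x : ℝ => x ^ k) ν ∧ ∫ x, x ^ k ∂ν = M k

/-- A (measurable) real random variable that is almost surely bounded. -/
def IsBoundedRV {Ω : Type*} [MeasurableSpace Ω] (P : Measure Ω) (Y : Ω → ℝ) : Prop :=
  AEMeasurable Y P ∧ ∃ C : ℝ, ∀ᵐ ω ∂P, |Y ω| ≤ C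

/-- A measurable probability density on the line. -/
def IsProbDensity (f : ℝ → ℝ) : Prop :=
  Measurable f ∧ (∀ x, 0 ≤ f x) ∧ ∫⁻ x, ENNReal.ofReal (f x) = 1

/-- The measure `f(x) dx`. -/
def densityMeasure (f : ℝ → ℝ) : Measure ℝ :=
  volume.withDensity fun x => ENNReal.ofReal (f x)

/-- The measure `τ f(x) dx + (1 - τ) δ_0`. -/
def mixture (τ : ℝ) (f : ℝ → ℝ) : Measure ℝ :=
  ENNReal.ofReal τ • densityMeasure f + ENNReal.ofReal (1 - τ) • Measure.dirac 0

/-! ### The random Jacobi operator and its spectral measure -/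

/-- The law on `ℝ^ℤ` of a doubly infinite i.i.d. sequence with common law `μ`. -/
def iidLaw (μ : Measure ℝ) : Measure (ℤ → ℝ) := Measure.infinitePi fun _ : ℤ => μ

instance (μ : Measure ℝ) [IsProbabilityMeasure μ] : IsProbabilityMeasure (iidLaw μ) := by
  unfold iidLaw; infer_instance

/-- The Hilbert space `ℓ²(ℤ; L²(ℝ^ℤ))` of square summable sequences of square integrable
random variables. -/
abbrev JacobiSpace (μ : Measure ℝ) : Type :=
  lp (fun _ : ℤ => Lp ℂ 2 (iidLaw μ)) 2

/-- The vector that is the constant `1` at position `0` and vanishes elsewhere. -/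
def jacobiVector (μ : Measure ℝ) [IsProbabilityMeasure μ] : JacobiSpace μ :=
  lp.single 2 (0 : ℤ) (Lp.const 2 (iidLaw μ) (1 : ℂ))

/-- `A` is the random Jacobi operator with zero diagonal and with off-diagonal entries the
i.i.d. coordinates: `(A x)_j = ω_j x_{j-1} + ω_{j+1} x_{j+1}` for every `x` and `j`. -/
def IsRandomJacobi (μ : Measure ℝ) (A : JacobiSpace μ →L[ℂ] JacobiSpace μ) : Prop :=
  ∀ (x : JacobiSpace μ) (j : ℤ), ∀ᵐ ω ∂(iidLaw μ),
    (A x j : (ℤ → ℝ) → ℂ) ω =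
      (ω j : ℂ) * (x (j - 1) : (ℤ → ℝ) → ℂ) ω + (ω (j + 1) : ℂ) * (x (j + 1) : (ℤ → ℝ) → ℂ) ω

/-- `ϖ` is the spectral measure `⟨ξ(dt) e, e⟩` of the bounded self-adjoint operator `A` at the
vector `e`: a finite measure carried by the spectrum with `∫ f dϖ = ⟨f(A) e, e⟩` for every
continuous `f`, where `f(A)` is given by the continuous functional calculus. -/
def IsSpectralMeasureAt {H : Type*} [NormedAddCommGroup H] [InnerProductSpace ℂ H]
    [CompleteSpace H] (A : H →L[ℂ] H) (e : H) (ϖ : Measure ℝ) : Prop :=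
  IsSelfAdjoint A ∧ IsFiniteMeasure ϖ ∧ ϖ (spectrum ℝ A)ᶜ = 0 ∧
    ∀ f : ℝ → ℝ, Continuous f → ((∫ t, f t ∂ϖ : ℝ) : ℂ) = inner ℂ e (cfc f A e)

/-! ### The explicit laws -/

/-- Ullman's density on `[-2, 2]`. -/
def ullmanDensity (α : ℝ) : ℝ → ℝ :=
  Set.indicator (Set.Icc (-2) 2) fun x =>
    1 / (α * Real.pi) *
      ∫ t in (|x| / 2)..1, t ^ (-1 + 1 / α) / Real.sqrt (4 * t ^ 2 - x ^ 2)

/-- The function `g_M`. -/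
def g (α : ℝ) (M : ℕ) (x : ℝ) : ℝ :=
  |x| ^ (1 / α - 1) * ∑ u ∈ Finset.Icc 1 ⌊(M : ℝ) * Real.arccos (|x| / 2) / Real.pi⌋₊,
    1 / (α * (2 : ℝ) ^ (1 / α) * |Real.cos (u * Real.pi / M)| ^ (1 / α))

/-- The density `f_{θ,α}`; the index `N ≥ 1` of the series `∑ θ^(N-1) g_{N+2}` is shifted to
start at `0`. -/
def bernoulliDensity (θ α : ℝ) : ℝ → ℝ :=
  Set.indicator (Set.Ioo (-2) 2) fun x =>
    (1 + θ) * (1 - θ) ^ 2 / 2 * ∑' N : ℕ, θ ^ N * g α (N + 3) x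

/-- The law `ν_{θ,α}`. -/
def bernoulliLaw (θ α : ℝ) : Measure ℝ :=
  if θ = 0 then Measure.dirac 0
  else if θ = 1 then densityMeasure (ullmanDensity α)
  else ENNReal.ofReal (2 * θ / (1 + θ)) • densityMeasure (bernoulliDensity θ α) +
    ENNReal.ofReal ((1 - θ) / (1 + θ)) • Measure.dirac 0

end TridiagonalMoments

end

namespace TridiagonalMoments

/-! The factor 1/(αk+1) is the k-th moment of T^α for T uniform on [0,1]. So it suffices to find a
law ϖ of bounded support whose k-th moment is the path sum in L_k: then T^α W, with W of law ϖ
independent of T, has moments L_k (`hasMoments_scaledLaw`). A law of bounded support is determined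
by its moments, even against competitors not assumed bounded (`HasMoments.eq_of_bounded`).

For a general bounded Y, expand A^k: the component of A^k e at 0 is the sum, over closed paths of
length k at 0, of the products of the entries ω along the steps (`IsRandomJacobi.pow_apply`). A
closed path crosses every line an even number of times, so by independence its expectation is a
product of the even moments m; translating each path to have maximum 0 gives the sum in L_k
(`integral_pathSum`). Thus ϖ is the spectral measure at e, which Riesz–Markov–Kakutani provides. For
w ≠ 0 the law of T^α w has an explicit density; integrating over w leaves only the atom ϖ{0} at 0
(`scaledLaw_eq`), whence the mixture.

In the Bernoulli case a path of depth r has weight θ^r. For θ < 1, θ^r = (1-θ)² ∑ θ^n (n+1-r)⁺, and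
(n+1-r)⁺ counts the translates of the path inside a segment of n+1 vertices. The path sum is
therefore a weighted sum of traces of powers of adjacency matrices of segments, whose eigenvalues
are 2cos(uπ/(n+2)) (`hasSum_trace`). So ϖ is an explicit discrete law; multiplying by T^α turns its
nonzero atoms into the functions g_M and keeps its atom at 0. For θ = 1, ϖ is the arcsine law and
the substitution x = 2t cos φ yields Ullman's density. The densities have mass 1 because the laws of
T^α W do. -/

/-! ### Paths with steps ±1 and weighted path sums -/

/-- The integer paths of length `k` with steps `±1` from `a` to `b`. -/
noncomputable def paths (k : ℕ) (a b : ℤ) : Finset (Fin (k + 1) → ℤ) :=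
  (Fintype.piFinset fun _ : Fin (k + 1) => Finset.Icc (a - k) (a + k)).filter fun γ =>
    γ 0 = a ∧ γ (Fin.last k) = b ∧ ∀ u : Fin k, |γ u.castSucc - γ u.succ| = 1

theorem abs_sub_zero_le_of_steps {k : ℕ} {γ : Fin (k + 1) → ℤ}
    (h : ∀ u : Fin k, |γ u.castSucc - γ u.succ| = 1) (n : ℕ) (hn : n < k + 1) :
    |γ ⟨n, hn⟩ - γ 0| ≤ n := by
  induction n with
  | zero => simp
  | succ n ih =>
    have h3 := h ⟨n, by omega⟩
    have h4 := ih (by omega)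
    simp only [Fin.castSucc_mk, Fin.succ_mk] at h3
    have h5 := abs_sub_le (γ ⟨n + 1, hn⟩) (γ ⟨n, by omega⟩) (γ 0)
    rw [abs_sub_comm] at h3
    push_cast
    linarith

/-- Unit steps cannot leave the box [a-k, a+k]; the box only makes the set visibly finite. -/
theorem mem_paths {k : ℕ} {a b : ℤ} {γ : Fin (k + 1) → ℤ} :
    γ ∈ paths k a b ↔
      γ 0 = a ∧ γ (Fin.last k) = b ∧ ∀ u : Fin k, |γ u.castSucc - γ u.succ| = 1 := by
  simp only [paths, Finset.mem_filter, Fintype.mem_piFinset, Finset.mem_Icc, and_iff_right_iff_imp]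
  rintro ⟨h0, -, h⟩ ⟨u, hu⟩
  have := abs_le.mp (abs_sub_zero_le_of_steps h u hu)
  omega

theorem snoc_mem_paths {k : ℕ} {a b c : ℤ} {γ : Fin (k + 1) → ℤ} (hγ : γ ∈ paths k a b)
    (h : |b - c| = 1) : (Fin.snoc γ c : Fin (k + 2) → ℤ) ∈ paths (k + 1) a c := by
  rw [mem_paths] at hγ ⊢
  refine ⟨?_, by simp, fun u => ?_⟩
  · rw [← Fin.castSucc_zero, Fin.snoc_castSucc]; exact hγ.1
  · refine Fin.lastCases ?_ (fun v => ?_) u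
    · rw [Fin.snoc_castSucc, Fin.succ_last, Fin.snoc_last, hγ.2.1, h]
    · rw [Fin.snoc_castSucc, ← Fin.castSucc_succ, Fin.snoc_castSucc]; exact hγ.2.2 v

theorem init_mem_paths {k : ℕ} {a b : ℤ} {γ : Fin (k + 2) → ℤ} (hγ : γ ∈ paths (k + 1) a b) :
    (Fin.init γ : Fin (k + 1) → ℤ) ∈ paths k a (γ (Fin.last k).castSucc) := by
  rw [mem_paths] at hγ ⊢
  exact ⟨hγ.1, rfl, fun u => hγ.2.2 u.castSucc⟩

/-- The vertex before the last is b-1 or b+1, and removing the last vertex is a bijection onto the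
two families of shorter paths. -/
theorem sum_paths_succ {M : Type*} [AddCommMonoid M] (k : ℕ) (a b : ℤ)
    (F : (Fin (k + 2) → ℤ) → M) :
    ∑ γ ∈ paths (k + 1) a b, F γ =
      ∑ γ ∈ paths k a (b - 1), F (Fin.snoc γ b) + ∑ γ ∈ paths k a (b + 1), F (Fin.snoc γ b) := by
  have hinj : Function.Injective fun γ : Fin (k + 1) → ℤ => (Fin.snoc γ b : Fin (k + 2) → ℤ) := by
    intro γ γ' h
    have := congrArg (fun δ : Fin (k + 2) → ℤ => (Fin.init δ : Fin (k + 1) → ℤ)) h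
    simpa using this
  have hdisj : Disjoint (paths k a (b - 1)) (paths k a (b + 1)) := by
    rw [Finset.disjoint_left]
    intro γ h1 h2
    have := (mem_paths.mp h1).2.1
    have := (mem_paths.mp h2).2.1
    omega
  rw [← Finset.sum_union hdisj]
  refine Eq.trans ?_ (Finset.sum_map _ ⟨_, hinj⟩ F)
  refine Finset.sum_congr ?_ fun _ _ => rfl
  ext γ
  simp only [Finset.mem_map, Finset.mem_union, Function.Embedding.coeFn_mk]
  constructor
  · intro h
    refine ⟨Fin.init γ, ?_, ?_⟩
    · have h1 := init_mem_paths h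
      have h2 := (mem_paths.mp h).2.2 (Fin.last k)
      rw [Fin.succ_last, (mem_paths.mp h).2.1] at h2
      rcases (abs_eq one_pos.le).mp h2 with h3 | h3
      · right; rwa [show b + 1 = γ (Fin.last k).castSucc by omega]
      · left; rwa [show b - 1 = γ (Fin.last k).castSucc by omega]
    · rw [← (mem_paths.mp h).2.1]; exact Fin.snoc_init_self γ
  · rintro ⟨δ, hδ | hδ, rfl⟩
    · exact snoc_mem_paths hδ (by norm_num)
    · exact snoc_mem_paths hδ (by norm_num)

/-- The sum over the paths from `a` to `b` of the products of the weights of their steps. -/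
noncomputable def pathSum {R : Type*} [CommSemiring R] (K : ℤ → ℤ → R) (k : ℕ) (a b : ℤ) : R :=
  ∑ γ ∈ paths k a b, ∏ u : Fin k, K (γ u.castSucc) (γ u.succ)

theorem pathSum_zero {R : Type*} [CommSemiring R] (K : ℤ → ℤ → R) (a b : ℤ) :
    pathSum K 0 a b = if a = b then 1 else 0 := by
  simp only [pathSum, Finset.univ_eq_empty, Finset.prod_empty, Finset.sum_const, nsmul_one]
  split_ifs with h
  · have : paths 0 a b = {fun _ => a} := by
      ext γ
      simp only [mem_paths, Finset.mem_singleton, funext_iff, h]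
      simp
    simp [this]
  · have : paths 0 a b = ∅ := by
      ext γ
      simp only [mem_paths]
      simp
      omega
    simp [this]

/-- This is the recursion for powers of a tridiagonal matrix with zero diagonal. Each evaluation of
a path sum below (random operator, segment, Fourier integral) checks that the other side obeys it.
-/
theorem pathSum_succ {R : Type*} [CommSemiring R] (K : ℤ → ℤ → R) (k : ℕ) (a b : ℤ) :
    pathSum K (k + 1) a b =
      pathSum K k a (b - 1) * K (b - 1) b + pathSum K k a (b + 1) * K (b + 1) b := by
  have key : ∀ c, ∑ γ ∈ paths k a c, (∏ u : Fin (k + 1),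
      K ((Fin.snoc γ b : Fin (k + 2) → ℤ) u.castSucc) ((Fin.snoc γ b : Fin (k + 2) → ℤ) u.succ)) =
      pathSum K k a c * K c b := by
    intro c
    rw [pathSum, Finset.sum_mul]
    refine Finset.sum_congr rfl fun γ hγ => ?_
    rw [Fin.prod_univ_castSucc]
    congr 1
    · refine Finset.prod_congr rfl fun u _ => ?_
      rw [Fin.snoc_castSucc, ← Fin.castSucc_succ, Fin.snoc_castSucc]
    · rw [Fin.snoc_castSucc, Fin.succ_last, Fin.snoc_last, (mem_paths.mp hγ).2.1]
  rw [pathSum, sum_paths_succ, key, key]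

/-! ### Translation -/

theorem crossings_add_const {k : ℕ} (γ : Fin (k + 1) → ℤ) (s i : ℤ) :
    crossings (fun u => γ u + s) i = crossings γ (i - s) := by
  unfold crossings
  congr 1
  ext u
  simp only [Finset.mem_filter, Finset.mem_univ, true_and]
  omega

theorem exists_max {k : ℕ} (γ : Fin (k + 1) → ℤ) : ∃ v, ∀ u, γ u ≤ γ v := by
  obtain ⟨v, -, hv⟩ := Finset.exists_max_image Finset.univ γ Finset.univ_nonempty
  exact ⟨v, fun u => hv u (Finset.mem_univ _)⟩

/-- A closed path can be normalized by its starting point or by its maximum. Each translation class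
contains exactly one path of either kind, and `F` is constant on the class. -/
theorem sum_paths_eq_sum_levelPaths {M : Type*} [AddCommMonoid M] (k : ℕ)
    (F : (Fin (k + 1) → ℤ) → M) (hF : ∀ γ s, F (fun u => γ u + s) = F γ) :
    ∑ γ ∈ paths k 0 0, F γ = ∑ γ ∈ levelPaths k, F γ := by
  symm
  refine Finset.sum_bij (fun γ _ => fun u => γ u + -γ 0) ?_ ?_ ?_ ?_
  · intro γ hγ
    rw [mem_levelPaths] at hγ
    rw [mem_paths]
    refine ⟨by simp, by simp [hγ.1], fun u => ?_⟩
    rw [← hγ.2.2 u]; congr 1; ring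
  · intro γ hγ δ hδ h
    rw [mem_levelPaths] at hγ hδ
    obtain ⟨-, ⟨hγ1, v, hv⟩, -⟩ := hγ
    obtain ⟨-, ⟨hδ1, w, hw⟩, -⟩ := hδ
    have h1 := congrFun h v
    have h2 := congrFun h w
    have h3 := hγ1 w
    have h4 := hδ1 v
    funext u
    have h5 := congrFun h u
    omega
  · intro γ hγ
    rw [mem_paths] at hγ
    obtain ⟨v, hv⟩ := exists_max γ
    refine ⟨fun u => γ u + -γ v, ?_, ?_⟩
    · rw [mem_levelPaths]
      refine ⟨by simp [hγ.1, hγ.2.1], ⟨fun u => by have := hv u; omega, v, by simp⟩, fun u => ?_⟩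
      rw [← hγ.2.2 u]; congr 1; ring
    · funext u
      simp [hγ.1]
  · intro γ _
    exact (hF γ _).symm

/-! ### Crossings -/

theorem crossings_eq_zero {k : ℕ} {γ : Fin (k + 1) → ℤ} {i : ℤ}
    (h : (∀ u, γ u ≤ i) ∨ ∀ u, i < γ u) : crossings γ i = 0 := by
  unfold crossings
  rw [Finset.card_eq_zero, Finset.filter_eq_empty_iff]
  rintro u -
  rcases h with h | h
  · have := h u.castSucc
    have := h u.succ
    omega
  · have := h u.castSucc
    have := h u.succ
    omega

/-- After n steps, the parity of the number of crossings tells whether the path is on the same side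
of the line as its start. A closed path ends on the side where it began. -/
theorem even_crossings {k : ℕ} {γ : Fin (k + 1) → ℤ} (h0 : γ 0 = γ (Fin.last k))
    (h : ∀ u : Fin k, |γ u.castSucc - γ u.succ| = 1) (i : ℤ) : Even (crossings γ i) := by
  have key : ∀ n (hn : n < k + 1), Even ((Finset.univ.filter fun u : Fin k => u.val < n ∧
      ((γ u.castSucc = i ∧ γ u.succ = i + 1) ∨ (γ u.castSucc = i + 1 ∧ γ u.succ = i))).card) ↔
      (γ 0 ≤ i ↔ γ ⟨n, hn⟩ ≤ i) := by
    intro n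
    induction n with
    | zero => intro hn; simp
    | succ n ih =>
      intro hn
      have ih := ih (by omega)
      have h3 := h ⟨n, by omega⟩
      simp only [Fin.castSucc_mk, Fin.succ_mk] at h3
      by_cases hc : (γ ⟨n, by omega⟩ = i ∧ γ ⟨n + 1, hn⟩ = i + 1) ∨
          (γ ⟨n, by omega⟩ = i + 1 ∧ γ ⟨n + 1, hn⟩ = i)
      · have : (Finset.univ.filter fun u : Fin k => u.val < n + 1 ∧
            ((γ u.castSucc = i ∧ γ u.succ = i + 1) ∨ (γ u.castSucc = i + 1 ∧ γ u.succ = i))) =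
            insert (⟨n, by omega⟩ : Fin k) (Finset.univ.filter fun u : Fin k => u.val < n ∧
            ((γ u.castSucc = i ∧ γ u.succ = i + 1) ∨ (γ u.castSucc = i + 1 ∧ γ u.succ = i))) := by
          ext u
          simp only [Finset.mem_filter, Finset.mem_univ, true_and, Finset.mem_insert, Fin.ext_iff]
          constructor
          · rintro ⟨h1, h2⟩
            rcases Nat.lt_succ_iff_lt_or_eq.mp h1 with h4 | h4
            · exact Or.inr ⟨h4, h2⟩
            · exact Or.inl h4
          · rintro (h1 | h1)
            · refine ⟨by omega, ?_⟩
              have : u = ⟨n, by omega⟩ := Fin.ext h1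
              rw [this]; exact hc
            · exact ⟨by omega, h1.2⟩
        rw [this, Finset.card_insert_of_notMem (by simp), Nat.even_add_one, ih]
        rcases hc with hc | hc <;> · rw [hc.1, hc.2]; constructor <;> intro _ <;> omega
      · have : (Finset.univ.filter fun u : Fin k => u.val < n + 1 ∧
            ((γ u.castSucc = i ∧ γ u.succ = i + 1) ∨ (γ u.castSucc = i + 1 ∧ γ u.succ = i))) =
            (Finset.univ.filter fun u : Fin k => u.val < n ∧
            ((γ u.castSucc = i ∧ γ u.succ = i + 1) ∨ (γ u.castSucc = i + 1 ∧ γ u.succ = i))) := by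
          ext u
          simp only [Finset.mem_filter, Finset.mem_univ, true_and]
          constructor
          · rintro ⟨h1, h2⟩
            rcases Nat.lt_succ_iff_lt_or_eq.mp h1 with h4 | h4
            · exact ⟨h4, h2⟩
            · have : u = ⟨n, by omega⟩ := Fin.ext h4
              rw [this] at h2
              exact absurd h2 hc
          · rintro ⟨h1, h2⟩
            exact ⟨by omega, h2⟩
        rw [this, ih]
        have : γ ⟨n, by omega⟩ ≤ i ↔ γ ⟨n + 1, hn⟩ ≤ i := by
          rcases (abs_eq one_pos.le).mp h3 with h4 | h4 <;> omega
        rw [this]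
  have := (key k (by omega)).mpr (by rw [h0]; rfl)
  unfold crossings
  convert this using 4
  simp

/-- Discrete intermediate value principle: without a crossing, every vertex stays on the side of the
starting point. -/
theorem crossings_pos {k : ℕ} {γ : Fin (k + 1) → ℤ} {i : ℤ}
    (h : ∀ u : Fin k, |γ u.castSucc - γ u.succ| = 1) {v w : Fin (k + 1)} (hv : γ v ≤ i)
    (hw : i < γ w) : 0 < crossings γ i := by
  by_contra hc
  have hc : crossings γ i = 0 := by omega
  unfold crossings at hc
  rw [Finset.card_eq_zero, Finset.filter_eq_empty_iff] at hc
  have key : ∀ n (hn : n < k + 1), γ ⟨n, hn⟩ ≤ i ↔ γ 0 ≤ i := by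
    intro n
    induction n with
    | zero => intro hn; rfl
    | succ n ih =>
      intro hn
      rw [← ih (by omega)]
      have h3 := h ⟨n, by omega⟩
      have h4 := hc (x := ⟨n, by omega⟩) (Finset.mem_univ _)
      simp only [Fin.castSucc_mk, Fin.succ_mk] at h3 h4
      rcases (abs_eq one_pos.le).mp h3 with h5 | h5 <;> omega
  have h1 := key v v.2
  have h2 := key w w.2
  simp only [Fin.eta] at h1 h2
  omega

/-- Group the steps by their lower end i: such a step crosses y = i + 1/2 and carries the weight of
its upper end, hence the index i + 1. -/
theorem prod_steps_eq_prod_crossings {R : Type*} [CommMonoid R] {k : ℕ} {b : ℤ}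
    {γ : Fin (k + 1) → ℤ} (hγ : γ ∈ paths k 0 b) (ω : ℤ → R) :
    ∏ u : Fin k, ω (max (γ u.castSucc) (γ u.succ)) =
      ∏ i ∈ Finset.Ico (-(k : ℤ)) k, ω (i + 1) ^ crossings γ i := by
  rw [mem_paths] at hγ
  have hmaps : ∀ u ∈ (Finset.univ : Finset (Fin k)),
      min (γ u.castSucc) (γ u.succ) ∈ Finset.Ico (-(k : ℤ)) k := by
    intro u _
    have h1 := abs_le.mp (abs_sub_zero_le_of_steps hγ.2.2 u.val (by omega))
    have h2 := abs_le.mp (abs_sub_zero_le_of_steps hγ.2.2 (u.val + 1) (by omega))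
    have h4 : u.castSucc = ⟨u.val, by omega⟩ := rfl
    have h5 : u.succ = ⟨u.val + 1, by omega⟩ := rfl
    rw [h4, h5, Finset.mem_Ico]
    have := hγ.1
    have := u.2
    push_cast at h2
    omega
  rw [← Finset.prod_fiberwise_of_maps_to hmaps]
  refine Finset.prod_congr rfl fun i _ => ?_
  have hstep : ∀ u : Fin k, (γ u.castSucc - γ u.succ = 1 ∨ γ u.castSucc - γ u.succ = -1) :=
    fun u => (abs_eq one_pos.le).mp (hγ.2.2 u)
  rw [Finset.prod_eq_pow_card (b := ω (i + 1))]
  · congr 1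
    unfold crossings
    congr 1
    ext u
    simp only [Finset.mem_filter, Finset.mem_univ, true_and]
    have := hstep u
    omega
  · intro u hu
    rw [Finset.mem_filter] at hu
    have := hstep u
    congr 1
    omega

/-- The product of `m` over the crossing numbers does not depend on the window of levels, provided
that the window contains all the crossed levels. -/
theorem prod_crossings_eq_finprod {k : ℕ} (γ : Fin (k + 1) → ℤ) (m : ℕ → ℝ) (hm : m 0 = 1)
    (s : Finset ℤ) (hs : ∀ i, crossings γ i ≠ 0 → i ∈ s) :
    ∏ i ∈ s, m (crossings γ i) = ∏ᶠ i, m (crossings γ i) := by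
  rw [finprod_eq_prod_of_mulSupport_subset]
  intro i hi
  rw [Function.mem_mulSupport] at hi
  refine hs i fun h => hi ?_
  rw [h, hm]

theorem mem_Ico_of_crossings_ne_zero {k : ℕ} {γ : Fin (k + 1) → ℤ} (hγ : γ ∈ levelPaths k)
    {i : ℤ} (hi : crossings γ i ≠ 0) : i ∈ Finset.Ico (-(k : ℤ)) 0 := by
  have hγ' := hγ
  rw [levelPaths, Finset.mem_filter, Fintype.mem_piFinset] at hγ'
  rw [Finset.mem_Ico]
  by_contra hc
  refine hi (crossings_eq_zero ?_)
  by_cases h : i < 0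
  · right
    intro u
    have := Finset.mem_Icc.mp (hγ'.1 u)
    omega
  · left
    intro u
    have := Finset.mem_Icc.mp (hγ'.1 u)
    omega

/-- Since `m 0 = 1`, both windows give the product over all lines of ℤ, which is translation
invariant; the change of normalization then applies. -/
theorem sum_paths_prod_crossings (k : ℕ) (m : ℕ → ℝ) (hm : m 0 = 1) :
    ∑ γ ∈ paths k 0 0, ∏ i ∈ Finset.Ico (-(k : ℤ)) k, m (crossings γ i) =
      ∑ γ ∈ levelPaths k, ∏ i ∈ Finset.Ico (-(k : ℤ)) 0, m (crossings γ i) := by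
  have h1 : ∀ γ ∈ paths k 0 0, ∏ i ∈ Finset.Ico (-(k : ℤ)) k, m (crossings γ i) =
      ∏ᶠ i, m (crossings γ i) := by
    intro γ hγ
    refine prod_crossings_eq_finprod γ m hm _ fun i hi => ?_
    rw [mem_paths] at hγ
    rw [Finset.mem_Ico]
    by_contra hc
    refine hi (crossings_eq_zero ?_)
    have hb : ∀ u, -(k : ℤ) ≤ γ u ∧ γ u ≤ k := fun u => by
      have := abs_le.mp (abs_sub_zero_le_of_steps hγ.2.2 u.val u.2)
      simp only [Fin.eta] at this
      have := hγ.1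
      have := u.2
      omega
    by_cases h : i < k
    · right
      intro u
      have := hb u
      omega
    · left
      intro u
      have := hb u
      omega
  rw [Finset.sum_congr rfl h1, sum_paths_eq_sum_levelPaths k (fun γ => ∏ᶠ i, m (crossings γ i))]
  · refine Finset.sum_congr rfl fun γ hγ => ?_
    exact (prod_crossings_eq_finprod γ m hm _ fun i hi => mem_Ico_of_crossings_ne_zero hγ hi).symm
  · intro γ s
    simp only [crossings_add_const]
    exact finprod_comp_equiv (Equiv.subRight s) (f := fun i => m (crossings γ i))

theorem levelPaths_eq_empty {k : ℕ} (hk : ¬ Even k) : levelPaths k = ∅ := by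
  rw [Finset.eq_empty_iff_forall_notMem]
  intro γ hγ
  rw [mem_levelPaths] at hγ
  obtain ⟨h0, -, h⟩ := hγ
  have key : ∀ n (hn : n < k + 1), (Even (γ ⟨n, hn⟩ - γ 0) ↔ Even n) := by
    intro n
    induction n with
    | zero => intro hn; simp
    | succ n ih =>
      intro hn
      rw [Nat.even_add_one, ← ih (by omega)]
      have h3 := h ⟨n, by omega⟩
      simp only [Fin.castSucc_mk, Fin.succ_mk] at h3
      rcases (abs_eq one_pos.le).mp h3 with h5 | h5
      · rw [show γ ⟨n + 1, hn⟩ - γ 0 = (γ ⟨n, by omega⟩ - γ 0) - 1 by omega, Int.even_sub_one]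
      · rw [show γ ⟨n + 1, hn⟩ - γ 0 = (γ ⟨n, by omega⟩ - γ 0) + 1 by omega, Int.even_add_one]
  refine hk ((key k (by omega)).mp ?_)
  have : γ ⟨k, by omega⟩ = γ 0 := h0.symm
  simp [this]

/-- For odd k there is no closed path, so the case distinction in `L` is redundant. -/
theorem L_eq (α : ℝ) (m : ℕ → ℝ) (k : ℕ) :
    L α m k = 1 / (α * k + 1) *
      ∑ γ ∈ levelPaths k, ∏ i ∈ Finset.Ico (-(k : ℤ)) 0, m (crossings γ i) := by
  rw [L]
  split_ifs with hk
  · rfl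
  · rw [levelPaths_eq_empty hk]
    simp

/-! ### Determinacy of measures with bounded support -/

theorem HasMoments.isFiniteMeasure {ν : Measure ℝ} {M : ℕ → ℝ} (h : HasMoments ν M) :
    IsFiniteMeasure ν := by
  have := (h 0).1
  simp only [pow_zero, integrable_const_iff, one_ne_zero, false_or] at this
  exact this

/-- The even moments grow at most like R^(2k). By Markov's inequality for x^(2k), the mass beyond
R+1 is at most a constant times (R/(R+1))^(2k), which tends to 0. -/
theorem HasMoments.ae_abs_le {ν ρ : Measure ℝ} {M : ℕ → ℝ} (hρ : HasMoments ρ M) {R : ℝ}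
    (hR : ∀ᵐ x ∂ρ, |x| ≤ R) (hR0 : 0 ≤ R) (hν : HasMoments ν M) : ∀ᵐ x ∂ν, |x| ≤ R + 1 := by
  have := hρ.isFiniteMeasure
  have := hν.isFiniteMeasure
  have hc : 0 < R + 1 := by linarith
  have hk : ∀ k : ℕ, ν.real {x | R + 1 ≤ |x|} ≤ ((R / (R + 1)) ^ 2) ^ k * ρ.real Set.univ := by
    intro k
    have h1 : ∫ x, x ^ (2 * k) ∂ρ ≤ R ^ (2 * k) * ρ.real Set.univ := by
      have : ∫ x, x ^ (2 * k) ∂ρ ≤ ∫ _x, R ^ (2 * k) ∂ρ := by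
        refine integral_mono_ae (hρ _).1 (integrable_const _) ?_
        filter_upwards [hR] with x hx
        calc x ^ (2 * k) = |x| ^ (2 * k) := by rw [pow_mul, pow_mul, sq_abs]
          _ ≤ R ^ (2 * k) := pow_le_pow_left₀ (abs_nonneg x) hx _
      simpa [mul_comm] using this
    have h2 := mul_meas_ge_le_integral_of_nonneg (μ := ν) (f := fun x : ℝ => x ^ (2 * k))
      (Filter.Eventually.of_forall fun x => by simp only [pow_mul]; positivity) (hν _).1
      ((R + 1) ^ (2 * k))
    have h3 : ν.real {x | R + 1 ≤ |x|} ≤ ν.real {x | (R + 1) ^ (2 * k) ≤ x ^ (2 * k)} := by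
      refine measureReal_mono fun x hx => ?_
      calc (R + 1) ^ (2 * k) ≤ |x| ^ (2 * k) := pow_le_pow_left₀ hc.le hx _
        _ = x ^ (2 * k) := by rw [pow_mul, pow_mul, sq_abs]
    rw [(hν _).2, ← (hρ _).2] at h2
    have hpos : 0 < (R + 1) ^ (2 * k) := by positivity
    have h4 : (R + 1) ^ (2 * k) * ν.real {x | R + 1 ≤ |x|} ≤ R ^ (2 * k) * ρ.real Set.univ :=
      (mul_le_mul_of_nonneg_left h3 hpos.le).trans (h2.trans h1)
    rw [← pow_mul, div_pow, div_mul_eq_mul_div, le_div_iff₀ hpos, mul_comm]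
    exact h4
  have hlim : Filter.Tendsto (fun k : ℕ => ((R / (R + 1)) ^ 2) ^ k * ρ.real Set.univ) Filter.atTop
      (nhds (0 * ρ.real Set.univ)) := by
    refine (tendsto_pow_atTop_nhds_zero_of_lt_one (by positivity) ?_).mul_const _
    have : R / (R + 1) < 1 := (div_lt_one hc).mpr (by linarith)
    have : 0 ≤ R / (R + 1) := by positivity
    nlinarith
  rw [zero_mul] at hlim
  have h0 : ν.real {x | R + 1 ≤ |x|} = 0 :=
    le_antisymm (ge_of_tendsto' hlim hk) measureReal_nonneg
  rw [measureReal_eq_zero_iff] at h0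
  have : ∀ᵐ x ∂ν, ¬ (R + 1 ≤ |x|) := by
    rw [ae_iff]
    simpa using h0
  filter_upwards [this] with x hx
  exact (not_le.mp hx).le

theorem HasMoments.integral_eval_eq {ν : Measure ℝ} {M : ℕ → ℝ} (hν : HasMoments ν M)
    (p : Polynomial ℝ) : Integrable (fun x => p.eval x) ν ∧
      ∫ x, p.eval x ∂ν = ∑ i ∈ p.support, p.coeff i * M i := by
  have h : (fun x => p.eval x) = fun x => ∑ i ∈ p.support, p.coeff i * x ^ i := by
    funext x
    rw [Polynomial.eval_eq_sum, Polynomial.sum]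
  have hi : ∀ i ∈ p.support, Integrable (fun x => p.coeff i * x ^ i) ν :=
    fun i _ => (hν i).1.const_mul _
  rw [h]
  refine ⟨integrable_finsetSum _ hi, ?_⟩
  rw [integral_finsetSum _ hi]
  refine Finset.sum_congr rfl fun i _ => ?_
  rw [integral_const_mul, (hν i).2]

/-- A measure with bounded support is the only one with its moments. -/
theorem HasMoments.eq_of_bounded {ν ρ : Measure ℝ} {M : ℕ → ℝ} (hρ : HasMoments ρ M) {R : ℝ}
    (hR : ∀ᵐ x ∂ρ, |x| ≤ R) (hν : HasMoments ν M) : ν = ρ := by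
  have := hρ.isFiniteMeasure
  have := hν.isFiniteMeasure
  have hR0 : ∀ᵐ x ∂ρ, |x| ≤ |R| := hR.mono fun x hx => hx.trans (le_abs_self R)
  have hS := hρ.ae_abs_le hR0 (abs_nonneg R) hν
  have hS' : ∀ᵐ x ∂ρ, |x| ≤ |R| + 1 := hR0.mono fun x hx => by linarith
  refine ext_of_forall_integral_eq_of_IsFiniteMeasure fun f => ?_
  have hmass : ν.real Set.univ = ρ.real Set.univ := by
    have h1 := (hν 0).2
    have h2 := (hρ 0).2
    simp only [pow_zero, integral_const, smul_eq_mul, mul_one] at h1 h2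
    rw [h1, h2]
  have key : ∀ ε : ℝ, 0 < ε → |∫ x, f x ∂ν - ∫ x, f x ∂ρ| ≤ ε * (2 * ρ.real Set.univ) := by
    intro ε hε
    -- Weierstrass on an interval that carries both measures; the integral of `p` depends only on
    -- `M`, hence is the same for both.
    obtain ⟨p, hp⟩ := exists_polynomial_near_of_continuousOn (-(|R| + 1)) (|R| + 1) f
      f.continuous.continuousOn ε hε
    have bound : ∀ (τ : Measure ℝ) [IsFiniteMeasure τ], HasMoments τ M →
        (∀ᵐ x ∂τ, |x| ≤ |R| + 1) →
        |∫ x, f x ∂τ - ∑ i ∈ p.support, p.coeff i * M i| ≤ ε * τ.real Set.univ := by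
      intro τ _ hτ hb
      rw [← (hτ.integral_eval_eq p).2, ← integral_sub (f.integrable τ) (hτ.integral_eval_eq p).1,
        ← Real.norm_eq_abs]
      refine norm_integral_le_of_norm_le_const ?_
      filter_upwards [hb] with x hx
      rw [Real.norm_eq_abs, abs_sub_comm]
      exact (hp x (abs_le.mp hx)).le
    have h1 := bound ν hν hS
    have h2 := bound ρ hρ hS'
    rw [hmass] at h1
    rw [abs_sub_comm] at h2
    have := abs_sub_le (∫ x, f x ∂ν) (∑ i ∈ p.support, p.coeff i * M i) (∫ x, f x ∂ρ)
    linarith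
  have hlim : Filter.Tendsto (fun ε : ℝ => ε * (2 * ρ.real Set.univ)) (nhdsWithin 0 (Set.Ioi 0))
      (nhds (0 * (2 * ρ.real Set.univ))) :=
    ((continuous_id.mul continuous_const).tendsto 0).mono_left nhdsWithin_le_nhds
  rw [zero_mul] at hlim
  have := ge_of_tendsto hlim (eventually_nhdsWithin_of_forall fun ε hε => key ε hε)
  exact sub_eq_zero.mp (abs_nonpos_iff.mp this)

/-! ### The law of `T ^ α * W` -/

/-- The law of `T ^ α * W` where `T` is uniform on `[0, 1]` and `W` is independent of `T` with
law `ϖ`. -/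
noncomputable def scaledLaw (α : ℝ) (ϖ : Measure ℝ) : Measure ℝ :=
  ((volume.restrict (Set.Icc (0 : ℝ) 1)).prod ϖ).map fun p => p.1 ^ α * p.2

theorem measurable_rpow_mul (α : ℝ) : Measurable fun p : ℝ × ℝ => p.1 ^ α * p.2 := by
  fun_prop

instance : IsProbabilityMeasure (volume.restrict (Set.Icc (0 : ℝ) 1)) :=
  ⟨by simp⟩

instance (α : ℝ) (ϖ : Measure ℝ) [IsProbabilityMeasure ϖ] :
    IsProbabilityMeasure (scaledLaw α ϖ) :=
  Measure.isProbabilityMeasure_map (measurable_rpow_mul α).aemeasurable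

theorem ae_abs_rpow_mul_le {α : ℝ} (hα : 0 < α) {ϖ : Measure ℝ} [SFinite ϖ] {R : ℝ}
    (hR : ∀ᵐ w ∂ϖ, |w| ≤ R) :
    ∀ᵐ p ∂((volume.restrict (Set.Icc (0 : ℝ) 1)).prod ϖ), |p.1 ^ α * p.2| ≤ R := by
  have h1 : ∀ᵐ p ∂((volume.restrict (Set.Icc (0 : ℝ) 1)).prod ϖ), p.1 ∈ Set.Icc (0 : ℝ) 1 :=
    Measure.quasiMeasurePreserving_fst.ae (ae_restrict_mem measurableSet_Icc)
  have h2 : ∀ᵐ p ∂((volume.restrict (Set.Icc (0 : ℝ) 1)).prod ϖ), |p.2| ≤ R :=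
    Measure.quasiMeasurePreserving_snd.ae hR
  filter_upwards [h1, h2] with p hp1 hp2
  rw [abs_mul, abs_of_nonneg (Real.rpow_nonneg hp1.1 α)]
  calc p.1 ^ α * |p.2| ≤ 1 * |p.2| := by
        gcongr
        exact Real.rpow_le_one hp1.1 hp1.2 hα.le
    _ ≤ R := by linarith

theorem ae_abs_le_scaledLaw {α : ℝ} (hα : 0 < α) {ϖ : Measure ℝ} [SFinite ϖ] {R : ℝ}
    (hR : ∀ᵐ w ∂ϖ, |w| ≤ R) : ∀ᵐ x ∂(scaledLaw α ϖ), |x| ≤ R := by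
  rw [scaledLaw, ae_map_iff (measurable_rpow_mul α).aemeasurable
    (measurableSet_le (by fun_prop) measurable_const)]
  exact ae_abs_rpow_mul_le hα hR

theorem integral_rpow_pow {α : ℝ} (hα : 0 < α) (k : ℕ) :
    ∫ t in Set.Icc (0 : ℝ) 1, (t ^ α) ^ k = 1 / (α * k + 1) := by
  have h : 0 ≤ α * k := by positivity
  rw [integral_Icc_eq_integral_Ioc, ← intervalIntegral.integral_of_le zero_le_one]
  have : ∫ t in (0 : ℝ)..1, (t ^ α) ^ k = ∫ t in (0 : ℝ)..1, t ^ (α * k) := by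
    refine intervalIntegral.integral_congr fun t ht => ?_
    rw [Set.uIcc_of_le zero_le_one] at ht
    exact (Real.rpow_mul_natCast ht.1 α k).symm
  rw [this, integral_rpow (Or.inl (by linarith)), Real.one_rpow, Real.zero_rpow (by positivity),
    sub_zero]

/-- By independence the k-th moment factors into those of T^α, namely 1/(αk+1), and of W. -/
theorem hasMoments_scaledLaw {α : ℝ} (hα : 0 < α) {ϖ : Measure ℝ} [IsFiniteMeasure ϖ] {R : ℝ}
    (hR : ∀ᵐ w ∂ϖ, |w| ≤ R) {M : ℕ → ℝ}
    (hM : ∀ k : ℕ, M k = 1 / (α * k + 1) * ∫ w, w ^ k ∂ϖ) : HasMoments (scaledLaw α ϖ) M := by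
  intro k
  have : IsFiniteMeasure (scaledLaw α ϖ) := by unfold scaledLaw; infer_instance
  refine ⟨?_, ?_⟩
  · refine Integrable.of_bound (by fun_prop) (|R| ^ k) ?_
    filter_upwards [ae_abs_le_scaledLaw hα hR] with x hx
    rw [norm_pow, Real.norm_eq_abs]
    exact pow_le_pow_left₀ (abs_nonneg x) (hx.trans (le_abs_self R)) _
  · rw [scaledLaw, integral_map (measurable_rpow_mul α).aemeasurable (by fun_prop)]
    simp only [mul_pow]
    rw [integral_prod_mul (fun t : ℝ => (t ^ α) ^ k) fun w => w ^ k, integral_rpow_pow hα, hM]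

/-- The density of the law of `T ^ α * w` for `w ≠ 0`, and `0` for `w = 0`. -/
noncomputable def powerDensity (α w x : ℝ) : ℝ≥0∞ :=
  if 0 < x / w ∧ x / w ≤ 1 then
    ENNReal.ofReal (1 / α * |x| ^ (1 / α - 1) * |w| ^ (-(1 / α))) else 0

theorem measurable_powerDensity (α : ℝ) :
    Measurable fun p : ℝ × ℝ => powerDensity α p.1 p.2 := by
  unfold powerDensity
  refine Measurable.ite ?_ (by fun_prop) measurable_const
  exact (measurableSet_lt measurable_const (measurable_snd.div measurable_fst)).inter
    (measurableSet_le (measurable_snd.div measurable_fst) measurable_const)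

theorem powerDensity_neg (α w x : ℝ) : powerDensity α (-w) (-x) = powerDensity α w x := by
  simp only [powerDensity, neg_div_neg_eq, abs_neg]

/-- Change of variables t = (x/w)^(1/α), whose derivative in absolute value is `powerDensity α w x`.
-/
theorem lintegral_rpow_mul {α : ℝ} (hα : 0 < α) {w : ℝ} (hw : w ≠ 0) (F : ℝ → ℝ≥0∞) :
    ∫⁻ t in Set.Icc (0 : ℝ) 1, F (t ^ α * w) = ∫⁻ x, powerDensity α w x * F x := by
  have hs : MeasurableSet {x : ℝ | 0 < x / w ∧ x / w ≤ 1} :=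
    (measurableSet_lt measurable_const (measurable_id.div_const w)).inter
      (measurableSet_le (measurable_id.div_const w) measurable_const)
  -- The image misses t = 0, which is harmless because a point is null.
  have himg : (fun x : ℝ => (x / w) ^ (1 / α)) '' {x : ℝ | 0 < x / w ∧ x / w ≤ 1} =
      Set.Ioc 0 1 := by
    ext t
    simp only [Set.mem_image, Set.mem_ofPred_eq, Set.mem_Ioc]
    constructor
    · rintro ⟨x, ⟨h0, h1⟩, rfl⟩
      exact ⟨Real.rpow_pos_of_pos h0 _, Real.rpow_le_one h0.le h1 (by positivity)⟩
    · rintro ⟨h0, h1⟩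
      refine ⟨t ^ α * w, ?_, ?_⟩
      · rw [mul_div_cancel_right₀ _ hw]
        exact ⟨Real.rpow_pos_of_pos h0 _, Real.rpow_le_one h0.le h1 hα.le⟩
      · rw [mul_div_cancel_right₀ _ hw, one_div, Real.rpow_rpow_inv h0.le hα.ne']
  have hinj : Set.InjOn (fun x : ℝ => (x / w) ^ (1 / α)) {x : ℝ | 0 < x / w ∧ x / w ≤ 1} := by
    intro x hx y hy h
    have := Real.rpow_left_injOn (x := 1 / α) (by positivity) hx.1.le hy.1.le h
    field_simp at this
    exact this
  have hder : ∀ x ∈ {x : ℝ | 0 < x / w ∧ x / w ≤ 1},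
      HasDerivWithinAt (fun x : ℝ => (x / w) ^ (1 / α))
        (1 / w * (1 / α) * (x / w) ^ (1 / α - 1)) {x : ℝ | 0 < x / w ∧ x / w ≤ 1} x := by
    intro x hx
    exact (((hasDerivAt_id x).div_const w).rpow_const (Or.inl hx.1.ne')).hasDerivWithinAt
  rw [Measure.restrict_congr_set Ioc_ae_eq_Icc.symm, ← himg,
    lintegral_image_eq_lintegral_abs_deriv_mul hs hder hinj (fun t => F (t ^ α * w)),
    ← lintegral_indicator hs]
  refine lintegral_congr fun x => ?_
  rw [Set.indicator_apply, powerDensity]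
  simp only [Set.mem_ofPred_eq]
  split_ifs with hx
  · have hF : ((x / w) ^ (1 / α)) ^ α * w = x := by
      rw [one_div, Real.rpow_inv_rpow hx.1.le hα.ne', div_mul_cancel₀ _ hw]
    rw [hF]
    congr 2
    have hw' : 0 < |w| := abs_pos.mpr hw
    have hx' : x / w = |x| / |w| := by rw [← abs_div, abs_of_pos hx.1]
    rw [hx', abs_mul, abs_mul, abs_of_nonneg (Real.rpow_nonneg (by positivity) _),
      abs_of_pos (by positivity : 0 < 1 / α), Real.div_rpow (abs_nonneg x) hw'.le, abs_div, abs_one,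
      Real.rpow_sub hw' (1 / α) 1, Real.rpow_one, Real.rpow_neg hw'.le]
    field_simp
  · rw [zero_mul]

/-- Condition on W = w and exchange the integrals. Values w ≠ 0 contribute a density, and w = 0
sends all its mass to 0. -/
theorem lintegral_powerDensity_eq {α : ℝ} (hα : 0 < α) {ϖ : Measure ℝ} [SFinite ϖ]
    {F : ℝ → ℝ≥0∞} (hF : Measurable F) :
    ∫⁻ x, F x ∂(scaledLaw α ϖ) =
      (∫⁻ x, (∫⁻ w, powerDensity α w x ∂ϖ) * F x) + ϖ {0} * F 0 := by
  have hmeas : Measurable fun p : ℝ × ℝ => F (p.1 ^ α * p.2) := hF.comp (measurable_rpow_mul α)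
  have hpd : Measurable fun p : ℝ × ℝ => powerDensity α p.1 p.2 * F p.2 :=
    (measurable_powerDensity α).mul (hF.comp measurable_snd)
  rw [scaledLaw, lintegral_map hF (measurable_rpow_mul α),
    lintegral_prod_symm _ hmeas.aemeasurable]
  have h1 : ∀ w, ∫⁻ t in Set.Icc (0 : ℝ) 1, F (t ^ α * w) =
      (∫⁻ x, powerDensity α w x * F x) + Set.indicator {0} (fun _ => F 0) w := by
    intro w
    by_cases hw : w = 0
    · subst hw
      -- For w = 0 the convention x / 0 = 0 makes the density vanish, and the left side averages the
      -- constant `F 0` over an interval of length 1.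
      simp [powerDensity]
    · rw [lintegral_rpow_mul hα hw, Set.indicator_of_notMem (by simpa using hw), add_zero]
  simp only [h1]
  rw [lintegral_add_right _ (measurable_const.indicator (measurableSet_singleton 0)),
    lintegral_indicator_const (measurableSet_singleton 0), mul_comm (F 0)]
  congr 1
  rw [lintegral_lintegral_swap hpd.aemeasurable]
  refine lintegral_congr fun x => ?_
  rw [lintegral_mul_const]
  exact (measurable_powerDensity α).comp measurable_prodMk_right

theorem measurable_lintegral_powerDensity (α : ℝ) (ϖ : Measure ℝ) [SFinite ϖ] :
    Measurable fun x => ∫⁻ w, powerDensity α w x ∂ϖ :=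
  (measurable_powerDensity α).lintegral_prod_left'

theorem scaledLaw_eq {α : ℝ} (hα : 0 < α) (ϖ : Measure ℝ) [SFinite ϖ] :
    scaledLaw α ϖ = volume.withDensity (fun x => ∫⁻ w, powerDensity α w x ∂ϖ) +
      ϖ {0} • Measure.dirac 0 := by
  refine Measure.ext_of_lintegral _ fun F hF => ?_
  rw [lintegral_powerDensity_eq hα hF, lintegral_add_measure, lintegral_smul_measure,
    lintegral_dirac, lintegral_withDensity_eq_lintegral_mul _
      (measurable_lintegral_powerDensity α ϖ) hF]
  rfl

/-- Comparing total masses in `scaledLaw_eq` normalizes the explicit densities below without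
computing an integral. -/
theorem lintegral_lintegral_powerDensity {α : ℝ} (hα : 0 < α) (ϖ : Measure ℝ)
    [IsProbabilityMeasure ϖ] :
    ∫⁻ x, ∫⁻ w, powerDensity α w x ∂ϖ = 1 - ϖ {0} := by
  have h := congrArg (fun ρ : Measure ℝ => ρ Set.univ) (scaledLaw_eq hα ϖ)
  simp only [measure_univ, Measure.coe_add, Pi.add_apply, withDensity_apply _ MeasurableSet.univ,
    Measure.restrict_univ, Measure.smul_apply, smul_eq_mul, mul_one] at h
  rw [h, ENNReal.add_sub_cancel_right (measure_ne_top _ _)]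

/-! ### Spectral measures of bounded self-adjoint operators -/

section SpectralMeasure

variable {H : Type*} [NormedAddCommGroup H] [InnerProductSpace ℂ H] [CompleteSpace H]

/-- Riesz–Markov–Kakutani on the compact spectrum, for the functional f ↦ Re⟨e, f(A)e⟩; it is
positive because f ≥ 0 gives f(A) ≥ 0. -/
theorem exists_isSpectralMeasureAt {A : H →L[ℂ] H} (hA : IsSelfAdjoint A) (e : H) :
    ∃ ϖ : Measure ℝ, IsSpectralMeasureAt A e ϖ := by
  have : CompactSpace (spectrum ℝ A) :=
    isCompact_iff_compactSpace.mp (ContinuousFunctionalCalculus.isCompact_spectrum A)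
  let Λ₀ : CompactlySupportedContinuousMap (spectrum ℝ A) ℝ →ₗ[ℝ] ℝ :=
    { toFun := fun f => (inner ℂ e (cfcHom hA f.toContinuousMap e)).re
      map_add' := fun f g => by
        have : (f + g).toContinuousMap = f.toContinuousMap + g.toContinuousMap := rfl
        rw [this, map_add, add_apply, inner_add_right, Complex.add_re]
      map_smul' := fun c f => by
        have : (c • f).toContinuousMap = c • f.toContinuousMap := rfl
        rw [this, map_smul, smul_apply, inner_smul_right_eq_smul]
        simp }
  have hΛ₀ : ∀ f, 0 ≤ f → 0 ≤ Λ₀ f := by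
    intro f hf
    have h1 : 0 ≤ cfcHom hA f.toContinuousMap := (cfcHom_nonneg_iff hA).mpr fun x => hf x
    rw [ContinuousLinearMap.nonneg_iff_isPositive] at h1
    exact h1.re_inner_nonneg_right e
  let Λ := PositiveLinearMap.mk₀ Λ₀ hΛ₀
  refine ⟨(RealRMK.rieszMeasure Λ).map Subtype.val, hA, inferInstance, ?_, fun f hf => ?_⟩
  · have hm : MeasurableSet (spectrum ℝ A) :=
      (ContinuousFunctionalCalculus.isCompact_spectrum A).measurableSet
    rw [Measure.map_apply measurable_subtype_coe hm.compl]
    convert measure_empty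
    · ext x
      simp
    · infer_instance
  · rw [integral_map measurable_subtype_coe.aemeasurable hf.aestronglyMeasurable]
    have h1 := RealRMK.integral_rieszMeasure Λ
      (CompactlySupportedContinuousMap.continuousMapEquiv
        (⟨fun x : spectrum ℝ A => f x, hf.comp continuous_subtype_val⟩ : C(spectrum ℝ A, ℝ)))
    have h2 : Λ (CompactlySupportedContinuousMap.continuousMapEquiv
        (⟨fun x : spectrum ℝ A => f x, hf.comp continuous_subtype_val⟩ : C(spectrum ℝ A, ℝ))) =
        (inner ℂ e (cfc f A e)).re := by
      rw [cfc_apply f A hA hf.continuousOn]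
      rfl
    rw [h2] at h1
    -- Taking the real part loses nothing, since f(A) is self-adjoint for real f.
    have h3 : ((inner ℂ e (cfc f A e)).re : ℂ) = inner ℂ e (cfc f A e) := by
      have h4 : IsSelfAdjoint (cfc f A) := cfc_predicate f A
      rw [ContinuousLinearMap.isSelfAdjoint_iff_isSymmetric] at h4
      exact h4.coe_re_inner_self_apply e
    rw [← h3, ← h1]
    rfl

theorem IsSpectralMeasureAt.integral_pow {A : H →L[ℂ] H} {e : H} {ϖ : Measure ℝ}
    (h : IsSpectralMeasureAt A e ϖ) (k : ℕ) :
    ((∫ t, t ^ k ∂ϖ : ℝ) : ℂ) = inner ℂ e ((A ^ k) e) := by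
  have hA := h.1
  rw [h.2.2.2 _ (continuous_pow k), cfc_pow (fun x => x) k A, cfc_id' ℝ A]

theorem IsSpectralMeasureAt.ae_abs_le {A : H →L[ℂ] H} {e : H} {ϖ : Measure ℝ}
    (h : IsSpectralMeasureAt A e ϖ) : ∃ R, ∀ᵐ w ∂ϖ, |w| ≤ R := by
  obtain ⟨R, hR⟩ :=
    (ContinuousFunctionalCalculus.isCompact_spectrum (R := ℝ) A).isBounded.exists_norm_le
  refine ⟨R, ?_⟩
  have h1 : ∀ᵐ w ∂ϖ, w ∈ spectrum ℝ A := by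
    rw [ae_iff]
    exact h.2.2.1
  filter_upwards [h1] with w hw
  exact hR w hw

end SpectralMeasure

/-! ### Weighted shifts -/

section WeightedShift

variable {G : Type*} [NormedAddCommGroup G] [InnerProductSpace ℂ G]

theorem exists_weightedShift (T : ℤ → G →L[ℂ] G) {C : ℝ} (hC : 0 ≤ C) (hT : ∀ j, ‖T j‖ ≤ C)
    (σ : Equiv.Perm ℤ) :
    ∃ B : lp (fun _ : ℤ => G) 2 →L[ℂ] lp (fun _ : ℤ => G) 2, ∀ x j, B x j = T j (x (σ j)) := by
  have h2 : (0 : ℝ) < (2 : ℝ≥0∞).toReal := by norm_num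
  have hle : ∀ (x : lp (fun _ : ℤ => G) 2) (j : ℤ),
      ‖T j (x (σ j))‖ ^ (2 : ℝ≥0∞).toReal ≤ C ^ (2 : ℝ≥0∞).toReal * ‖x (σ j)‖ ^ (2 : ℝ≥0∞).toReal := by
    intro x j
    rw [← Real.mul_rpow hC (norm_nonneg _)]
    exact Real.rpow_le_rpow (norm_nonneg _) ((T j).le_of_opNorm_le (hT j) _) h2.le
  have hsum : ∀ x : lp (fun _ : ℤ => G) 2,
      Summable fun j => C ^ (2 : ℝ≥0∞).toReal * ‖x (σ j)‖ ^ (2 : ℝ≥0∞).toReal := fun x =>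
    (σ.summable_iff.mpr ((memℓp_gen_iff h2).mp x.2)).mul_left _
  have hmem : ∀ x : lp (fun _ : ℤ => G) 2, Memℓp (fun j => T j (x (σ j))) 2 := fun x =>
    memℓp_gen (Summable.of_nonneg_of_le (fun j => Real.rpow_nonneg (norm_nonneg _) _) (hle x)
      (hsum x))
  let B₀ : lp (fun _ : ℤ => G) 2 →ₗ[ℂ] lp (fun _ : ℤ => G) 2 :=
    { toFun := fun x => ⟨fun j => T j (x (σ j)), hmem x⟩
      map_add' := fun x y => by
        ext j
        exact map_add (T j) _ _
      map_smul' := fun c x => by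
        ext j
        exact map_smul (T j) c _ }
  refine ⟨B₀.mkContinuous C fun x => ?_, fun x j => rfl⟩
  refine lp.norm_le_of_tsum_le h2 (mul_nonneg hC (norm_nonneg x)) ?_
  calc ∑' j, ‖B₀ x j‖ ^ (2 : ℝ≥0∞).toReal
      ≤ ∑' j, C ^ (2 : ℝ≥0∞).toReal * ‖x (σ j)‖ ^ (2 : ℝ≥0∞).toReal :=
        ((memℓp_gen_iff h2).mp (hmem x)).tsum_le_tsum (hle x) (hsum x)
    _ = (C * ‖x‖) ^ (2 : ℝ≥0∞).toReal := by
        rw [tsum_mul_left, σ.tsum_eq (fun j => ‖x j‖ ^ (2 : ℝ≥0∞).toReal),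
          Real.mul_rpow hC (norm_nonneg _), lp.norm_rpow_eq_tsum h2]

/-- The Jacobi operator with zero diagonal whose off-diagonal entries are symmetric operators. -/
theorem exists_jacobi [CompleteSpace G] (T : ℤ → G →L[ℂ] G) {C : ℝ} (hC : 0 ≤ C)
    (hT : ∀ j, ‖T j‖ ≤ C) (hsymm : ∀ j x y, inner ℂ (T j x) y = inner ℂ x (T j y)) :
    ∃ A : lp (fun _ : ℤ => G) 2 →L[ℂ] lp (fun _ : ℤ => G) 2, IsSelfAdjoint A ∧
      ∀ x j, A x j = T j (x (j - 1)) + T (j + 1) (x (j + 1)) := by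
  obtain ⟨B₁, h₁⟩ := exists_weightedShift T hC hT (Equiv.subRight 1)
  obtain ⟨B₂, h₂⟩ := exists_weightedShift (fun j => T (j + 1)) hC (fun j => hT _)
    (Equiv.addRight 1)
  have hadj : ∀ x y, inner ℂ (B₁ x) y = inner ℂ x (B₂ y) := by
    intro x y
    -- Shifting the summation index by one exchanges the lower and the upper diagonal, so the two
    -- weighted shifts are adjoint to each other.
    rw [lp.inner_eq_tsum, lp.inner_eq_tsum, ← (Equiv.addRight (1 : ℤ)).tsum_eq]
    refine tsum_congr fun j => ?_
    simp only [h₁, h₂, Equiv.subRight_apply, Equiv.coe_addRight, add_sub_cancel_right, hsymm]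
  refine ⟨B₁ + B₂, ?_, fun x j => ?_⟩
  · rw [ContinuousLinearMap.isSelfAdjoint_iff_isSymmetric]
    intro x y
    have h3 : inner ℂ (B₂ x) y = inner ℂ x (B₁ y) := by
      rw [← inner_conj_symm, ← hadj, inner_conj_symm]
    simp only [ContinuousLinearMap.coe_coe, add_apply, inner_add_left,
      inner_add_right, hadj, h3]
    ring
  · have : (B₁ + B₂) x j = B₁ x j + B₂ x j := rfl
    rw [this, h₁, h₂]
    rfl

end WeightedShift

/-! ### Multiplication operators -/

/-- Multiplication by an essentially bounded function is bounded on L², and it is symmetric because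
the function is real. These operators are the entries of the Jacobi operator. -/
theorem exists_mulOperator {X : Type*} [MeasurableSpace X] {P : Measure X} {φ : X → ℝ}
    (hφ : Measurable φ) {C : ℝ} (hC : 0 ≤ C) (hb : ∀ᵐ ω ∂P, |φ ω| ≤ C) :
    ∃ T : Lp ℂ 2 P →L[ℂ] Lp ℂ 2 P, ‖T‖ ≤ C ∧
      (∀ f : Lp ℂ 2 P, (T f : X → ℂ) =ᵐ[P] fun ω => (φ ω : ℂ) * f ω) ∧
      ∀ f g : Lp ℂ 2 P, inner ℂ (T f) g = inner ℂ f (T g) := by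
  have hbound : ∀ f : Lp ℂ 2 P, ∀ᵐ ω ∂P, ‖(φ ω : ℂ) * f ω‖ ≤ C * ‖f ω‖ := fun f => by
    filter_upwards [hb] with ω hω
    rw [norm_mul, Complex.norm_real, Real.norm_eq_abs]
    exact mul_le_mul_of_nonneg_right hω (norm_nonneg _)
  have hmem : ∀ f : Lp ℂ 2 P, MemLp (fun ω => (φ ω : ℂ) * f ω) 2 P := fun f =>
    (Lp.memLp f).of_le_mul
      ((Complex.measurable_ofReal.comp hφ).aestronglyMeasurable.mul (Lp.aestronglyMeasurable f))
      (hbound f)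
  let T₀ : Lp ℂ 2 P →ₗ[ℂ] Lp ℂ 2 P :=
    { toFun := fun f => (hmem f).toLp _
      map_add' := fun f g => by
        rw [← MemLp.toLp_add]
        refine MemLp.toLp_congr _ _ ?_
        filter_upwards [Lp.coeFn_add f g] with ω hω
        simp only [hω, Pi.add_apply, mul_add]
      map_smul' := fun c f => by
        rw [RingHom.id_apply, ← MemLp.toLp_const_smul]
        refine MemLp.toLp_congr _ _ ?_
        filter_upwards [Lp.coeFn_smul c f] with ω hω
        simp only [hω, Pi.smul_apply, smul_eq_mul]
        ring }
  have hT₀ : ∀ f : Lp ℂ 2 P, (T₀ f : X → ℂ) =ᵐ[P] fun ω => (φ ω : ℂ) * f ω := fun f =>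
    (hmem f).coeFn_toLp
  have hT₀b : ∀ f, ‖T₀ f‖ ≤ C * ‖f‖ := fun f => by
    refine Lp.norm_le_mul_norm_of_ae_le_mul ?_
    filter_upwards [hT₀ f, hbound f] with ω h1 h2
    rw [h1]
    exact h2
  refine ⟨T₀.mkContinuous C hT₀b, LinearMap.mkContinuous_norm_le _ hC _, hT₀, fun f g => ?_⟩
  rw [L2.inner_def, L2.inner_def]
  refine integral_congr_ae ?_
  filter_upwards [hT₀ f, hT₀ g] with ω h1 h2
  rw [LinearMap.mkContinuous_apply, LinearMap.mkContinuous_apply, h1, h2]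
  simp only [RCLike.inner_apply, map_mul, Complex.conj_ofReal]
  ring

/-! ### Moments of the random Jacobi operator -/

section Jacobi

variable {μ : Measure ℝ} [IsProbabilityMeasure μ]

theorem measurePreserving_coord (j : ℤ) : MeasurePreserving (fun ω : ℤ → ℝ => ω j) (iidLaw μ) μ :=
  measurePreserving_eval_infinitePi (fun _ : ℤ => μ) j

theorem ae_forall_abs_coord_le {C : ℝ} (hC : ∀ᵐ y ∂μ, |y| ≤ C) :
    ∀ᵐ ω ∂(iidLaw μ), ∀ j : ℤ, |ω j| ≤ C :=
  ae_all_iff.mpr fun j => (measurePreserving_coord j).quasiMeasurePreserving.ae hC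

theorem exists_isRandomJacobi {C : ℝ} (hC0 : 0 ≤ C) (hC : ∀ᵐ y ∂μ, |y| ≤ C) :
    ∃ A : JacobiSpace μ →L[ℂ] JacobiSpace μ, IsSelfAdjoint A ∧ IsRandomJacobi μ A := by
  choose T hT hTf hTs using fun j : ℤ => exists_mulOperator (P := iidLaw μ)
    (φ := fun ω : ℤ → ℝ => ω j) (measurable_pi_apply j) hC0
    ((ae_forall_abs_coord_le hC).mono fun ω h => h j)
  obtain ⟨A, hA, hAf⟩ := exists_jacobi T hC0 hT hTs
  refine ⟨A, hA, fun x j => ?_⟩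
  rw [hAf]
  filter_upwards [Lp.coeFn_add (T j (x (j - 1))) (T (j + 1) (x (j + 1))), hTf j (x (j - 1)),
    hTf (j + 1) (x (j + 1))] with ω h1 h2 h3
  rw [h1, Pi.add_apply, h2, h3]

/-- For almost every ω, the action of the operator is the recursion `pathSum_succ` with weight ω at
the upper end of each step. -/
theorem IsRandomJacobi.pow_apply {A : JacobiSpace μ →L[ℂ] JacobiSpace μ} (hA : IsRandomJacobi μ A)
    (k : ℕ) (j : ℤ) : ∀ᵐ ω ∂(iidLaw μ), ((A ^ k) (jacobiVector μ) j : (ℤ → ℝ) → ℂ) ω =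
      ((pathSum (fun a b => ω (max a b)) k 0 j : ℝ) : ℂ) := by
  induction k generalizing j with
  | zero =>
    simp only [pow_zero, one_apply_eq_self, pathSum_zero, jacobiVector]
    by_cases hj : 0 = j
    · subst hj
      rw [lp.single_apply_self]
      filter_upwards [Lp.coeFn_const 2 (iidLaw μ) (1 : ℂ)] with ω hω
      rw [hω]
      simp
    · rw [lp.single_apply_ne _ _ _ (Ne.symm hj)]
      filter_upwards [Lp.coeFn_zero ℂ 2 (iidLaw μ)] with ω hω
      rw [hω]
      simp [hj]
  | succ k ih =>
    rw [pow_succ']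
    filter_upwards [hA ((A ^ k) (jacobiVector μ)) j, ih (j - 1), ih (j + 1)] with ω h1 h2 h3
    rw [mul_apply_eq_comp, h1, h2, h3, pathSum_succ,
      max_eq_right (by omega : j - 1 ≤ j), max_eq_left (by omega : j ≤ j + 1)]
    push_cast
    ring

theorem integral_prod_coord_pow (s : Finset ℤ) (c : ℤ → ℕ) :
    ∫ ω, ∏ i ∈ s, ω (i + 1) ^ c i ∂(iidLaw μ) = ∏ i ∈ s, ∫ y, y ^ c i ∂μ := by
  have hind : iIndepFun (fun (i : ℤ) (ω : ℤ → ℝ) => ω i) (iidLaw μ) :=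
    iIndepFun_infinitePi (X := fun _ y => y) fun _ => measurable_id
  -- Independence is used along the injective reindexing i ↦ i + 1, so distinct lines carry distinct
  -- coordinates.
  have hinj : Function.Injective fun i : s => (i : ℤ) + 1 := fun i j h => by
    ext
    simpa using h
  have h := (hind.precomp hinj).integral_fun_prod_comp (f := fun (i : s) (y : ℝ) => y ^ c i)
    (fun i => (measurable_pi_apply _).aemeasurable)
    (fun i => (continuous_pow _).aestronglyMeasurable)
  have h1 : ∀ ω : ℤ → ℝ, ∏ i : s, ω (i + 1) ^ c i = ∏ i ∈ s, ω (i + 1) ^ c i := fun ω =>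
    Finset.prod_coe_sort s fun i => ω (i + 1) ^ c i
  simp only [h1] at h
  rw [h, ← Finset.prod_coe_sort s fun i => ∫ y, y ^ c i ∂μ]
  refine Finset.prod_congr rfl fun i _ => ?_
  exact (measurePreserving_coord (μ := μ) ((i : ℤ) + 1)).hasLaw.integral_comp
    (f := fun y => y ^ c i) (continuous_pow _).aestronglyMeasurable

theorem integrable_prod_coord_pow {C : ℝ} (hC : ∀ᵐ y ∂μ, |y| ≤ C) (s : Finset ℤ) (c : ℤ → ℕ) :
    Integrable (fun ω : ℤ → ℝ => ∏ i ∈ s, ω (i + 1) ^ c i) (iidLaw μ) := by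
  refine Integrable.of_bound ?_ (∏ i ∈ s, C ^ c i) ?_
  · refine Measurable.aestronglyMeasurable ?_
    exact Finset.measurable_fun_prod _ fun i _ => (measurable_pi_apply (i + 1)).pow_const _
  · filter_upwards [ae_forall_abs_coord_le hC] with ω hω
    rw [Real.norm_eq_abs, Finset.abs_prod]
    refine Finset.prod_le_prod (fun i _ => abs_nonneg _) fun i _ => ?_
    rw [abs_pow]
    exact pow_le_pow_left₀ (abs_nonneg _) (hω _) _

/-- The coordinate attached to a line occurs with an exponent equal to its crossing number, which is
even; hence knowledge of the even moments suffices. -/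
theorem integral_pathSum {C : ℝ} (hC : ∀ᵐ y ∂μ, |y| ≤ C) {m : ℕ → ℝ}
    (hm : ∀ k : ℕ, ∫ y, y ^ (2 * k) ∂μ = m (2 * k)) (k : ℕ) :
    ∫ ω, pathSum (fun a b => ω (max a b)) k 0 0 ∂(iidLaw μ) =
      ∑ γ ∈ levelPaths k, ∏ i ∈ Finset.Ico (-(k : ℤ)) 0, m (crossings γ i) := by
  have hm0 : m 0 = 1 := by
    have := hm 0
    simpa using this.symm
  have h1 : ∀ ω : ℤ → ℝ, pathSum (fun a b => ω (max a b)) k 0 0 =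
      ∑ γ ∈ paths k 0 0, ∏ i ∈ Finset.Ico (-(k : ℤ)) k, ω (i + 1) ^ crossings γ i := fun ω =>
    Finset.sum_congr rfl fun γ hγ => prod_steps_eq_prod_crossings hγ ω
  simp only [h1]
  rw [integral_finsetSum _ fun γ _ => integrable_prod_coord_pow hC _ _,
    ← sum_paths_prod_crossings k m hm0]
  refine Finset.sum_congr rfl fun γ hγ => ?_
  rw [integral_prod_coord_pow]
  refine Finset.prod_congr rfl fun i _ => ?_
  rw [mem_paths] at hγ
  obtain ⟨n, hn⟩ := (even_crossings (hγ.1.trans hγ.2.1.symm) hγ.2.2 i)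
  rw [hn, ← two_mul, hm]

theorem integral_pow_spectralMeasure {A : JacobiSpace μ →L[ℂ] JacobiSpace μ} {ϖ : Measure ℝ}
    (hA : IsRandomJacobi μ A) (h : IsSpectralMeasureAt A (jacobiVector μ) ϖ) {C : ℝ}
    (hC : ∀ᵐ y ∂μ, |y| ≤ C) {m : ℕ → ℝ} (hm : ∀ k : ℕ, ∫ y, y ^ (2 * k) ∂μ = m (2 * k)) (k : ℕ) :
    ∫ t, t ^ k ∂ϖ = ∑ γ ∈ levelPaths k, ∏ i ∈ Finset.Ico (-(k : ℤ)) 0, m (crossings γ i) := by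
  rw [← integral_pathSum hC hm k, ← Complex.ofReal_inj, h.integral_pow, jacobiVector,
    lp.inner_single_left, L2.inner_def]
  refine Eq.trans (integral_congr_ae ?_) (integral_ofReal (𝕜 := ℂ))
  filter_upwards [hA.pow_apply k 0, Lp.coeFn_const 2 (iidLaw μ) (1 : ℂ)] with ω h1 h2
  rw [h2]
  simp only [jacobiVector] at h1
  rw [h1]
  simp

end Jacobi

/-! ### The representation for a general bounded variable -/

/-- The law of `T ^ α * W` is a mixture of an absolutely continuous law and of `δ_0`. -/
theorem exists_scaledLaw_eq_mixture {α : ℝ} (hα : 0 < α) (ϖ : Measure ℝ) [IsProbabilityMeasure ϖ] :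
    ∃ (τ : ℝ) (f : ℝ → ℝ), 0 ≤ τ ∧ τ ≤ 1 ∧ IsProbDensity f ∧ scaledLaw α ϖ = mixture τ f := by
  set F : ℝ → ℝ≥0∞ := fun x => ∫⁻ w, powerDensity α w x ∂ϖ with hF
  have hFm : Measurable F := measurable_lintegral_powerDensity α ϖ
  have hmass : ∫⁻ x, F x = 1 - ϖ {0} := lintegral_lintegral_powerDensity hα ϖ
  have hle : ϖ {0} ≤ 1 := prob_le_one
  set τ : ℝ := (1 - ϖ {0}).toReal with hτ
  have hτ0 : 0 ≤ τ := ENNReal.toReal_nonneg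
  have hne : 1 - ϖ {0} ≠ ∞ := ENNReal.sub_ne_top ENNReal.one_ne_top
  have hτ1 : τ ≤ 1 := by
    rw [hτ]
    exact ENNReal.toReal_le_of_le_ofReal zero_le_one (by simp)
  have hofτ : ENNReal.ofReal τ = 1 - ϖ {0} := ENNReal.ofReal_toReal hne
  have hof1 : ENNReal.ofReal (1 - τ) = ϖ {0} := by
    rw [ENNReal.ofReal_sub _ hτ0, hofτ, ENNReal.ofReal_one, ENNReal.sub_sub_cancel
      ENNReal.one_ne_top hle]
  rcases hτ0.eq_or_lt with h0 | hpos
  -- Here the law is δ_0 and the density has weight 0; any probability density will do, for instance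
  -- the uniform one.
  · refine ⟨τ, Set.indicator (Set.Icc 0 1) fun _ => 1, hτ0, hτ1, ⟨?_, ?_, ?_⟩, ?_⟩
    · exact measurable_const.indicator measurableSet_Icc
    · exact fun x => Set.indicator_nonneg (fun _ _ => zero_le_one) x
    · have : ∀ x : ℝ, ENNReal.ofReal (Set.indicator (Set.Icc 0 1) (fun _ => (1 : ℝ)) x) =
          Set.indicator (Set.Icc (0 : ℝ) 1) (fun _ => (1 : ℝ≥0∞)) x := fun x => by
        by_cases hx : x ∈ Set.Icc (0 : ℝ) 1 <;> simp [hx]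
      simp only [this]
      rw [lintegral_indicator_const measurableSet_Icc]
      simp
    · have hF0 : F =ᵐ[volume] 0 := by
        rw [← lintegral_eq_zero_iff hFm, hmass, ← hofτ, ← h0, ENNReal.ofReal_zero]
      rw [mixture, scaledLaw_eq hα, withDensity_congr_ae hF0, hof1, ← h0]
      simp
  · have hfin : ∀ᵐ x, F x < ∞ := ae_lt_top hFm (by rw [hmass]; exact hne)
    have hof : ∀ᵐ x, ENNReal.ofReal ((F x).toReal / τ) = (ENNReal.ofReal τ)⁻¹ * F x := by
      filter_upwards [hfin] with x hx
      rw [div_eq_inv_mul, ENNReal.ofReal_mul (inv_nonneg.mpr hτ0), ENNReal.ofReal_toReal hx.ne,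
        ENNReal.ofReal_inv_of_pos hpos]
    have hτne : ENNReal.ofReal τ ≠ 0 := by simpa using hpos
    refine ⟨τ, fun x => (F x).toReal / τ, hτ0, hτ1,
      ⟨hFm.ennreal_toReal.div_const τ, fun x => by positivity, ?_⟩, ?_⟩
    · rw [lintegral_congr_ae hof, lintegral_const_mul _ hFm, hmass, ← hofτ,
        ENNReal.inv_mul_cancel hτne ENNReal.ofReal_ne_top]
    · rw [mixture, densityMeasure, withDensity_congr_ae hof, scaledLaw_eq hα, hof1]
      congr 1
      rw [← withDensity_smul _ (hFm.const_mul _)]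
      congr 1
      funext x
      rw [Pi.smul_apply, smul_eq_mul, ← mul_assoc,
        ENNReal.mul_inv_cancel hτne ENNReal.ofReal_ne_top, one_mul]

/-- If the `m (2 k)` are the even moments of a bounded variable, then the `L α m k` are the moments
of `T ^ α * W`, where `W` follows the spectral law of the random Jacobi operator. -/
theorem exists_jacobi_representation {α : ℝ} (hα : 0 < α) {m : ℕ → ℝ} {μ : Measure ℝ}
    [IsProbabilityMeasure μ] {C : ℝ} (hC : ∀ᵐ y ∂μ, |y| ≤ C)
    (hm : ∀ k : ℕ, ∫ y, y ^ (2 * k) ∂μ = m (2 * k)) :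
    ∃ (A : JacobiSpace μ →L[ℂ] JacobiSpace μ) (ϖ : Measure ℝ),
      IsRandomJacobi μ A ∧ IsSpectralMeasureAt A (jacobiVector μ) ϖ ∧
      ∃ (Ω' : Type) (_ : MeasurableSpace Ω') (P' : Measure Ω') (_ : IsProbabilityMeasure P')
        (T W Z : Ω' → ℝ),
        HasLaw T (volume.restrict (Set.Icc 0 1)) P' ∧ HasLaw W ϖ P' ∧ IndepFun T W P' ∧
        Z = (fun ω => T ω ^ α * W ω) ∧ IsBoundedRV P' Z ∧ HasMoments (P'.map Z) (L α m) ∧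
        (∀ ν : Measure ℝ, HasMoments ν (L α m) → ν = P'.map Z) ∧
        ∃ (τ : ℝ) (f : ℝ → ℝ), 0 ≤ τ ∧ τ ≤ 1 ∧ IsProbDensity f ∧ P'.map Z = mixture τ f := by
  obtain ⟨A, hAs, hA⟩ := exists_isRandomJacobi (μ := μ) (abs_nonneg C)
    (hC.mono fun y hy => hy.trans (le_abs_self C))
  obtain ⟨ϖ, hϖ⟩ := exists_isSpectralMeasureAt hAs (jacobiVector μ)
  have hfin : IsFiniteMeasure ϖ := hϖ.2.1
  have hmom := integral_pow_spectralMeasure hA hϖ hC hm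
  -- The mass of ϖ is its moment of order 0, that is ‖e‖² = 1.
  have hprob : IsProbabilityMeasure ϖ := by
    have h0 := hϖ.integral_pow 0
    have h1 : ‖Lp.const 2 (iidLaw μ) (1 : ℂ)‖ = 1 := by
      rw [Lp.norm_const _ _ _ (by norm_num)]
      simp
    rw [pow_zero, one_apply_eq_self, inner_self_eq_norm_sq_to_K, jacobiVector,
      lp.norm_single (by norm_num), h1] at h0
    have h2 : ϖ.real Set.univ = 1 := by
      have h3 : ∫ t, t ^ 0 ∂ϖ = 1 := by
        rw [← Complex.ofReal_inj, h0]
        simp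
      simpa using h3
    refine ⟨?_⟩
    rw [← ENNReal.toReal_eq_one_iff]
    exact h2
  obtain ⟨R, hR⟩ := hϖ.ae_abs_le
  have hlaw : HasMoments (scaledLaw α ϖ) (L α m) :=
    hasMoments_scaledLaw hα hR fun k => by rw [L_eq, hmom]
  refine ⟨A, ϖ, hA, hϖ, ℝ × ℝ, inferInstance, (volume.restrict (Set.Icc (0 : ℝ) 1)).prod ϖ,
    inferInstance, Prod.fst, Prod.snd, fun p => p.1 ^ α * p.2, measurePreserving_fst.hasLaw,
    measurePreserving_snd.hasLaw, indepFun_prod measurable_id measurable_id, rfl,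
    ⟨(measurable_rpow_mul α).aemeasurable, R, ae_abs_rpow_mul_le hα hR⟩, hlaw, fun ν hν => ?_,
    exists_scaledLaw_eq_mixture hα ϖ⟩
  exact hlaw.eq_of_bounded (ae_abs_le_scaledLaw hα hR) hν

/-! ### Closed walks in a finite segment -/

/-- The adjacency matrix of the path graph with `n` vertices. -/
noncomputable def segmentMatrix (n : ℕ) : Matrix (Fin n) (Fin n) ℝ :=
  fun i j => if |(i : ℤ) - j| = 1 then 1 else 0

/-- The weight `1` for the steps inside `[0, n)`, and `0` for all the other steps. -/
noncomputable def segmentKernel (n : ℕ) (a b : ℤ) : ℝ :=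
  if a ∈ Finset.Ico (0 : ℤ) n ∧ b ∈ Finset.Ico (0 : ℤ) n then 1 else 0

theorem sum_fin_eq_sum_Ico {M : Type*} [AddCommMonoid M] (n : ℕ) (g : ℤ → M) :
    ∑ l : Fin n, g l = ∑ z ∈ Finset.Ico (0 : ℤ) n, g z := by
  refine Finset.sum_bij (fun (l : Fin n) _ => (l : ℤ)) ?_ ?_ ?_ ?_
  · intro l _
    rw [Finset.mem_Ico]
    have := l.2
    omega
  · intro a _ b _ h
    ext
    exact_mod_cast h
  · intro z hz
    rw [Finset.mem_Ico] at hz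
    exact ⟨⟨z.toNat, by omega⟩, Finset.mem_univ _, by simp [hz.1]⟩
  · intro _ _
    rfl

/-- At an end of the segment one neighbour lies outside, and the kernel removes its term. The
function may thus live on all of ℤ and be matched with `pathSum_succ`. -/
theorem sum_mul_segmentMatrix {n : ℕ} (g : ℤ → ℝ) (j : Fin n) :
    ∑ l : Fin n, g l * segmentMatrix n l j =
      g (j - 1) * segmentKernel n (j - 1) j + g (j + 1) * segmentKernel n (j + 1) j := by
  have h := sum_fin_eq_sum_Ico n fun z => g z * if |z - (j : ℤ)| = 1 then 1 else 0
  have hj : (j : ℤ) ∈ Finset.Ico (0 : ℤ) n := by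
    rw [Finset.mem_Ico]
    have := j.2
    omega
  have h2 : ∀ z : ℤ, (g z * if |z - (j : ℤ)| = 1 then 1 else 0) =
      (if z = j - 1 then g (j - 1) else 0) + (if z = j + 1 then g (j + 1) else 0) := by
    intro z
    by_cases h1 : z = j - 1
    · subst h1
      have h3 : |(j : ℤ) - 1 - j| = 1 := by
        rw [show (j : ℤ) - 1 - j = -1 by ring]
        rfl
      rw [if_pos h3, if_pos rfl, if_neg (by omega), mul_one, add_zero]
    · by_cases h4 : z = j + 1
      · subst h4
        have h3 : |(j : ℤ) + 1 - j| = 1 := by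
          rw [show (j : ℤ) + 1 - j = 1 by ring]
          rfl
        rw [if_pos h3, if_pos rfl, if_neg h1, mul_one, zero_add]
      · have h3 : ¬ |z - (j : ℤ)| = 1 := by
          intro h5
          rcases (abs_eq one_pos.le).mp h5 with h6 | h6 <;> omega
        rw [if_neg h3, if_neg h1, if_neg h4, mul_zero, add_zero]
  simp only [h2] at h
  simp only [segmentMatrix, h2, h, segmentKernel, hj, and_true, Finset.sum_add_distrib,
    Finset.sum_ite_eq', mul_ite, mul_one, mul_zero]

theorem segmentMatrix_pow_apply {n : ℕ} (k : ℕ) (i j : Fin n) :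
    (segmentMatrix n ^ k) i j = pathSum (segmentKernel n) k i j := by
  induction k generalizing j with
  | zero =>
    rw [pow_zero, pathSum_zero, Matrix.one_apply]
    simp [Fin.ext_iff]
  | succ k ih =>
    rw [pow_succ, Matrix.mul_apply, pathSum_succ, ← sum_mul_segmentMatrix]
    exact Finset.sum_congr rfl fun l _ => by rw [ih]

/-! ### Depth, and traces as counts of translated paths -/

/-- The depth of a path with maximum `0`: the opposite of its minimum. -/
def depth {k : ℕ} (γ : Fin (k + 1) → ℤ) : ℕ := Finset.univ.sup fun u => (-γ u).toNat

theorem neg_depth_le {k : ℕ} (γ : Fin (k + 1) → ℤ) (u : Fin (k + 1)) : -(depth γ : ℤ) ≤ γ u := by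
  have := Finset.le_sup (f := fun u => (-γ u).toNat) (Finset.mem_univ u)
  change _ ≤ depth γ at this
  omega

theorem exists_eq_neg_depth {k : ℕ} {γ : Fin (k + 1) → ℤ} (hγ : γ ∈ levelPaths k) :
    ∃ u, γ u = -(depth γ : ℤ) := by
  obtain ⟨u, -, hu⟩ := Finset.exists_mem_eq_sup Finset.univ Finset.univ_nonempty
    fun u => (-γ u).toNat
  change depth γ = _ at hu
  have := (mem_levelPaths.mp hγ).2.1.1 u
  exact ⟨u, by omega⟩

theorem depth_le {k : ℕ} {γ : Fin (k + 1) → ℤ} (hγ : γ ∈ levelPaths k) : depth γ ≤ k := by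
  obtain ⟨u, hu⟩ := exists_eq_neg_depth hγ
  rw [levelPaths, Finset.mem_filter, Fintype.mem_piFinset] at hγ
  have := Finset.mem_Icc.mp (hγ.1 u)
  omega

/-- The crossed lines are exactly those between the minimum and 0, `depth γ` in number. Each is
crossed a positive even number of times and gives θ; every other line gives `m 0 = 1`. -/
theorem prod_crossings_eq_pow_depth {k : ℕ} {γ : Fin (k + 1) → ℤ} (hγ : γ ∈ levelPaths k)
    {m : ℕ → ℝ} {θ : ℝ} (hm0 : m 0 = 1) (hm : ∀ k : ℕ, 1 ≤ k → m (2 * k) = θ) :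
    ∏ i ∈ Finset.Ico (-(k : ℤ)) 0, m (crossings γ i) = θ ^ depth γ := by
  obtain ⟨u, hu⟩ := exists_eq_neg_depth hγ
  have hle := depth_le hγ
  have hγ' := mem_levelPaths.mp hγ
  obtain ⟨v, hv⟩ := hγ'.2.1.2
  have h1 : ∀ i ∈ Finset.Ico (-(k : ℤ)) 0,
      m (crossings γ i) = if -(depth γ : ℤ) ≤ i then θ else 1 := by
    intro i hi
    rw [Finset.mem_Ico] at hi
    split_ifs with h
    · have hpos := crossings_pos (i := i) hγ'.2.2 (v := u) (w := v) (by omega) (by omega)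
      obtain ⟨n, hn⟩ := even_crossings hγ'.1 hγ'.2.2 i
      rw [hn, ← two_mul, hm n (by omega)]
    · rw [crossings_eq_zero, hm0]
      right
      intro w
      have := neg_depth_le γ w
      omega
  rw [Finset.prod_congr rfl h1, Finset.prod_ite, Finset.prod_const, Finset.prod_const_one, mul_one]
  congr 1
  have h2 : (Finset.Ico (-(k : ℤ)) 0).filter (fun i => -(depth γ : ℤ) ≤ i) =
      Finset.Ico (-(depth γ : ℤ)) 0 := by
    ext i
    simp only [Finset.mem_filter, Finset.mem_Ico]
    omega
  rw [h2, Int.card_Ico]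
  omega

theorem prod_segmentKernel {n k : ℕ} {a b : ℤ} {γ : Fin (k + 1) → ℤ} (hγ : γ ∈ paths k a b)
    (ha : a ∈ Finset.Ico (0 : ℤ) n) :
    ∏ u : Fin k, segmentKernel n (γ u.castSucc) (γ u.succ) =
      if ∀ u, γ u ∈ Finset.Ico (0 : ℤ) n then 1 else 0 := by
  split_ifs with h
  · exact Finset.prod_eq_one fun u _ => if_pos ⟨h _, h _⟩
  · by_contra hne
    refine h fun u => ?_
    refine Fin.cases ?_ (fun v => ?_) u
    · rwa [(mem_paths.mp hγ).1]
    · by_contra hv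
      refine hne (Finset.prod_eq_zero (Finset.mem_univ v) (if_neg ?_))
      exact fun h' => hv h'.2

/-- The trace counts the closed paths inside [0, n). Such a path is a path of maximum 0 raised by
its own maximum s, and it fits exactly when depth ≤ s < n; truncated subtraction covers the paths
that are too deep. -/
theorem trace_segmentMatrix_pow (n k : ℕ) :
    (segmentMatrix n ^ k).trace = ∑ γ ∈ levelPaths k, ((n - depth γ : ℕ) : ℝ) := by
  have h1 : (segmentMatrix n ^ k).trace = ((((Finset.Ico (0 : ℤ) n).sigma fun a =>
      (paths k a a).filter fun γ => ∀ u, γ u ∈ Finset.Ico (0 : ℤ) n).card : ℕ) : ℝ) := by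
    rw [Matrix.trace, Finset.card_sigma, Nat.cast_sum]
    simp only [Matrix.diag_apply, segmentMatrix_pow_apply]
    rw [sum_fin_eq_sum_Ico n fun z => pathSum (segmentKernel n) k z z]
    refine Finset.sum_congr rfl fun a ha => ?_
    rw [pathSum, Finset.sum_congr rfl fun γ hγ => prod_segmentKernel hγ ha, Finset.sum_boole]
  have h2 : ∑ γ ∈ levelPaths k, ((n - depth γ : ℕ) : ℝ) =
      ((((levelPaths k).sigma fun γ => Finset.Ico (depth γ : ℤ) n).card : ℕ) : ℝ) := by
    rw [Finset.card_sigma, Nat.cast_sum]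
    refine Finset.sum_congr rfl fun γ _ => ?_
    rw [Int.card_Ico]
    congr 1
    omega
  rw [h1, h2]
  congr 1
  symm
  refine Finset.card_bij (fun p _ => ⟨p.1 0 + p.2, fun u => p.1 u + p.2⟩) ?_ ?_ ?_
  · rintro ⟨γ, s⟩ h
    rw [Finset.mem_sigma, Finset.mem_Ico, mem_levelPaths] at h
    obtain ⟨⟨h0, h3, h4⟩, h5, h6⟩ := h
    dsimp only at h0 h3 h4 h5 h6
    have hb : ∀ u, γ u + s ∈ Finset.Ico (0 : ℤ) n := fun u => by
      rw [Finset.mem_Ico]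
      have := neg_depth_le γ u
      have := h3.1 u
      omega
    rw [Finset.mem_sigma, Finset.mem_filter, mem_paths]
    refine ⟨hb 0, ⟨rfl, by simp only [h0], fun u => ?_⟩, hb⟩
    rw [← h4 u]
    congr 1
    ring
  · rintro ⟨γ, s⟩ h ⟨δ, t⟩ h' heq
    rw [Finset.mem_sigma, mem_levelPaths] at h h'
    have heq' : (fun u => γ u + s) = fun u => δ u + t := by
      have := congrArg (fun p : Σ _ : ℤ, Fin (k + 1) → ℤ => p.2) heq
      exact this
    obtain ⟨v, hv⟩ := h.1.2.1.2
    obtain ⟨w, hw⟩ := h'.1.2.1.2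
    have h3 := congrFun heq' v
    have h4 := congrFun heq' w
    have h5 := h.1.2.1.1 w
    have h6 := h'.1.2.1.1 v
    simp only at hv hw h3 h4 h5 h6
    have hst : s = t := by omega
    subst hst
    have : γ = δ := funext fun u => by
      have := congrFun heq' u
      omega
    subst this
    rfl
  · rintro ⟨a, γ⟩ h
    rw [Finset.mem_sigma, Finset.mem_filter, mem_paths] at h
    obtain ⟨-, ⟨h0, h1, h3⟩, h4⟩ := h
    simp only at h0 h1 h3 h4
    obtain ⟨v, hv⟩ := exists_max γ
    have hmem : (fun u => γ u + -γ v) ∈ levelPaths k := by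
      rw [mem_levelPaths]
      refine ⟨by simp [h0, h1], ⟨fun u => by have := hv u; omega, v, by simp⟩, fun u => ?_⟩
      rw [← h3 u]
      congr 1
      ring
    refine ⟨⟨fun u => γ u + -γ v, γ v⟩, ?_, ?_⟩
    · rw [Finset.mem_sigma, Finset.mem_Ico]
      refine ⟨hmem, ?_, (Finset.mem_Ico.mp (h4 v)).2⟩
      obtain ⟨w, hw⟩ := exists_eq_neg_depth hmem
      have := (Finset.mem_Ico.mp (h4 w)).1
      simp only at hw ⊢
      omega
    · simp [h0]

/-! ### The eigenvalues of the segment -/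

theorem sin_add_sin_shift (x φ : ℝ) :
    Real.sin (x - φ) + Real.sin (x + φ) = 2 * Real.cos φ * Real.sin x := by
  rw [Real.sin_sub, Real.sin_add]
  ring

/-- The vectors sin((j+1)φ), with φ = (u+1)π/(n+1), satisfy the eigenvector equation: the missing
neighbours at positions -1 and n would carry sin 0 and sin((u+1)π), both 0. The n eigenvalues 2cos φ
are distinct, so the matrix is diagonalized. -/
theorem trace_segmentMatrix_pow_eq_sum_cos (n k : ℕ) :
    (segmentMatrix n ^ k).trace =
      ∑ u ∈ Finset.range n, (2 * Real.cos ((u + 1 : ℕ) * Real.pi / (n + 1 : ℕ))) ^ k := by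
  set φ : ℕ → ℝ := fun u => (u + 1 : ℕ) * Real.pi / (n + 1 : ℕ) with hφ
  have hn : (0 : ℝ) < (n + 1 : ℕ) := by positivity
  have hφ0 : ∀ u, 0 < φ u := fun u => by simp only [hφ]; positivity
  have hφπ : ∀ u : Fin n, φ u < Real.pi := fun u => by
    simp only [hφ]
    rw [div_lt_iff₀ hn, mul_comm Real.pi]
    refine mul_lt_mul_of_pos_right ?_ Real.pi_pos
    exact_mod_cast Nat.succ_lt_succ u.2
  set V : Matrix (Fin n) (Fin n) ℝ := fun j u => Real.sin ((((j : ℤ) + 1 : ℤ) : ℝ) * φ u) with hV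
  have hAsymm : (segmentMatrix n).transpose = segmentMatrix n := by
    ext i j
    simp only [Matrix.transpose_apply, segmentMatrix, abs_sub_comm]
  have hAV : ∀ (j u : Fin n), ∑ l, V l u * segmentMatrix n l j = V j u * (2 * Real.cos (φ u)) := by
    intro j u
    have h := sum_mul_segmentMatrix (fun z : ℤ => Real.sin (((z + 1 : ℤ) : ℝ) * φ u)) j
    simp only [hV]
    rw [h]
    have h1 : Real.sin ((((j : ℤ) - 1 + 1 : ℤ) : ℝ) * φ u) * segmentKernel n (j - 1) j =
        Real.sin ((((j : ℤ) + 1 : ℤ) : ℝ) * φ u - φ u) := by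
      rw [segmentKernel]
      split_ifs with hc
      · rw [mul_one]
        congr 1
        push_cast
        ring
      · have hj : (j : ℤ) = 0 := by
          rw [Finset.mem_Ico, Finset.mem_Ico] at hc
          have := j.2
          omega
        rw [hj, mul_zero]
        norm_num
    have h2 : Real.sin ((((j : ℤ) + 1 + 1 : ℤ) : ℝ) * φ u) * segmentKernel n (j + 1) j =
        Real.sin ((((j : ℤ) + 1 : ℤ) : ℝ) * φ u + φ u) := by
      rw [segmentKernel]
      split_ifs with hc
      · rw [mul_one]
        congr 1
        push_cast
        ring
      · have hj : (j : ℕ) + 1 = n := by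
          rw [Finset.mem_Ico, Finset.mem_Ico] at hc
          have := j.2
          omega
        rw [mul_zero]
        have : (((j : ℤ) + 1 : ℤ) : ℝ) * φ u + φ u = (u + 1 : ℕ) * Real.pi := by
          have h3 : (((j : ℤ) + 1 : ℤ) : ℝ) = n := by exact_mod_cast congrArg (Nat.cast : ℕ → ℤ) hj
          rw [h3]
          simp only [hφ]
          field_simp
          push_cast
          ring
        rw [this, Real.sin_nat_mul_pi]
    rw [h1, h2, sin_add_sin_shift]
    ring
  have hVD : SemiconjBy V (Matrix.diagonal fun u : Fin n => 2 * Real.cos (φ u))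
      (segmentMatrix n) := by
    ext j u
    rw [Matrix.mul_diagonal, Matrix.mul_apply, ← hAV]
    refine Finset.sum_congr rfl fun l _ => ?_
    rw [mul_comm, ← hAsymm, Matrix.transpose_apply, hAsymm]
  have hunit : IsUnit V := by
    rw [← Matrix.linearIndependent_cols_iff_isUnit]
    refine Module.End.eigenvectors_linearIndependent' (segmentMatrix n).mulVecLin
      (fun u : Fin n => 2 * Real.cos (φ u)) ?_ _ fun u => ?_
    · intro u v huv
      have h1 : Real.cos (φ u) = Real.cos (φ v) := by simpa using huv
      have h2 := Real.injOn_cos ⟨(hφ0 u).le, (hφπ u).le⟩ ⟨(hφ0 v).le, (hφπ v).le⟩ h1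
      simp only [hφ] at h2
      have hπ := Real.pi_pos
      field_simp at h2
      ext
      have h3 : ((u : ℕ) + 1 : ℕ) = (v : ℕ) + 1 := by exact_mod_cast h2
      omega
    · rw [Module.End.hasEigenvector_iff, Module.End.mem_eigenspace_iff]
      constructor
      · funext j
        have := congrFun (congrFun hVD.eq j) u
        rw [Matrix.mul_diagonal, Matrix.mul_apply] at this
        simp only [Matrix.mulVecLin_apply, Matrix.mulVec, dotProduct, Matrix.col_apply,
          Pi.smul_apply, smul_eq_mul]
        rw [← this]
        ring
      · intro h0
        have h1 : V ⟨0, by have := u.2; omega⟩ u = 0 := congrFun h0 _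
        have h2 := Real.sin_pos_of_pos_of_lt_pi (hφ0 u) (hφπ u)
        simp [hV] at h1
        exact h2.ne' h1
  have hdet : IsUnit V.det := (Matrix.isUnit_iff_isUnit_det V).mp hunit
  have hpow := (hVD.pow_right k).eq
  have : segmentMatrix n ^ k =
      V * (Matrix.diagonal fun u : Fin n => 2 * Real.cos (φ u)) ^ k * V⁻¹ := by
    rw [hpow, Matrix.mul_nonsing_inv_cancel_right _ _ hdet]
  rw [this, Matrix.trace_mul_comm, ← Matrix.mul_assoc, Matrix.nonsing_inv_mul _ hdet,
    Matrix.one_mul, Matrix.diagonal_pow, Matrix.trace_diagonal,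
    ← Fin.sum_univ_eq_sum_range fun u => (2 * Real.cos (φ u)) ^ k]
  rfl

/-! ### The spectral law of the Bernoulli case -/

/-- The eigenvalues `2 cos (u π / M)`, `1 ≤ u < M`, of the segment with `M - 1` vertices. -/
noncomputable def segmentEigenvalue (M u : ℕ) : ℝ :=
  2 * Real.cos ((u + 1 : ℕ) * Real.pi / (M : ℕ))

theorem abs_segmentEigenvalue_le (M u : ℕ) : |segmentEigenvalue M u| ≤ 2 := by
  rw [segmentEigenvalue, abs_mul, abs_two]
  have := Real.abs_cos_le_one ((u + 1 : ℕ) * Real.pi / (M : ℕ))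
  linarith

/-- In percolation terms, θ^r is the probability that r given edges are open. They then lie in a
cluster with n edges, in one of its n+1-r positions; the factor (1-θ)² closes the two bounding
edges. -/
theorem hasSum_geometric_truncated {θ : ℝ} (h0 : 0 ≤ θ) (h1 : θ < 1) (r : ℕ) :
    HasSum (fun n : ℕ => (1 - θ) ^ 2 * θ ^ n * ((n + 1 - r : ℕ) : ℝ)) (θ ^ r) := by
  have h2 : ‖θ‖ < 1 := by rwa [Real.norm_eq_abs, abs_of_nonneg h0]
  have hne : (1 - θ) ≠ 0 := by linarith
  have h3 := (hasSum_choose_mul_geometric_of_norm_lt_one 1 h2).mul_left ((1 - θ) ^ 2 * θ ^ r)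
  have h4 : (1 - θ) ^ 2 * θ ^ r * (1 / (1 - θ) ^ (1 + 1)) = θ ^ r := by
    rw [one_add_one_eq_two]
    field_simp
  rw [h4] at h3
  -- The first r terms vanish by truncated subtraction; after a shift by r the series is ∑ (n+1)
  -- θ^n, up to a factor.
  have h5 := (hasSum_nat_add_iff (f := fun n : ℕ => (1 - θ) ^ 2 * θ ^ n * ((n + 1 - r : ℕ) : ℝ))
    (g := θ ^ r) r).mp ?_
  · rwa [Finset.sum_eq_zero, add_zero] at h5
    intro n hn
    rw [Finset.mem_range] at hn
    rw [Nat.sub_eq_zero_of_le (by omega)]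
    simp
  · refine Eq.subst (motive := fun f => HasSum f _) (funext fun n => Eq.symm ?_) h3
    rw [Nat.choose_one_right, show n + r + 1 - r = n + 1 by omega, pow_add]
    ring

/-- Expand each θ^depth and exchange the sums: the coefficient of θ^n is the trace on the segment
with n+1 vertices. -/
theorem hasSum_trace {θ : ℝ} (h0 : 0 ≤ θ) (h1 : θ < 1) (k : ℕ) :
    HasSum (fun n : ℕ => (1 - θ) ^ 2 * θ ^ n *
      ∑ u ∈ Finset.range (n + 1), segmentEigenvalue (n + 2) u ^ k)
      (∑ γ ∈ levelPaths k, θ ^ depth γ) := by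
  have h := hasSum_sum (s := levelPaths k)
    fun γ _ => hasSum_geometric_truncated h0 h1 (depth γ)
  convert h using 2 with n
  rw [← Finset.mul_sum, ← trace_segmentMatrix_pow, trace_segmentMatrix_pow_eq_sum_cos]
  rfl

/-- The mean spectral law of the clusters of a Bernoulli percolation of the edges of `ℤ`. -/
noncomputable def clusterLaw (θ : ℝ) : Measure ℝ :=
  Measure.sum fun n : ℕ => ENNReal.ofReal ((1 - θ) ^ 2 * θ ^ n) •
    ∑ u ∈ Finset.range (n + 1), Measure.dirac (segmentEigenvalue (n + 2) u)

theorem lintegral_clusterLaw (θ : ℝ) (F : ℝ → ℝ≥0∞) :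
    ∫⁻ w, F w ∂(clusterLaw θ) = ∑' n : ℕ, ENNReal.ofReal ((1 - θ) ^ 2 * θ ^ n) *
      ∑ u ∈ Finset.range (n + 1), F (segmentEigenvalue (n + 2) u) := by
  rw [clusterLaw, lintegral_sum_measure]
  refine tsum_congr fun n => ?_
  rw [lintegral_smul_measure, lintegral_finsetSum_measure, smul_eq_mul]
  simp only [lintegral_dirac]

theorem isProbabilityMeasure_clusterLaw {θ : ℝ} (h0 : 0 ≤ θ) (h1 : θ < 1) :
    IsProbabilityMeasure (clusterLaw θ) := by
  refine ⟨?_⟩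
  rw [← lintegral_one, lintegral_clusterLaw]
  have h := hasSum_geometric_truncated h0 h1 0
  have h2 : ∀ n : ℕ, ENNReal.ofReal ((1 - θ) ^ 2 * θ ^ n) *
      ∑ _u ∈ Finset.range (n + 1), (1 : ℝ≥0∞) =
      ENNReal.ofReal ((1 - θ) ^ 2 * θ ^ n * ((n + 1 - 0 : ℕ) : ℝ)) := fun n => by
    rw [ENNReal.ofReal_mul (p := (1 - θ) ^ 2 * θ ^ n) (by positivity), ENNReal.ofReal_natCast]
    simp
  simp only [h2]
  rw [← ENNReal.ofReal_tsum_of_nonneg (fun n => by positivity) h.summable, h.tsum_eq]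
  simp

theorem ae_abs_le_clusterLaw (θ : ℝ) : ∀ᵐ w ∂(clusterLaw θ), |w| ≤ 2 := by
  have hm : MeasurableSet {w : ℝ | ¬ |w| ≤ 2} :=
    (measurableSet_le (f := fun w : ℝ => |w|) (g := fun _ => (2 : ℝ)) (by fun_prop)
      (by fun_prop)).compl
  rw [ae_iff, ← lintegral_indicator_one hm, lintegral_clusterLaw, ENNReal.tsum_eq_zero]
  intro n
  rw [Finset.sum_eq_zero, mul_zero]
  intro u _
  exact Set.indicator_of_notMem (by simpa using abs_segmentEigenvalue_le _ _) _

theorem integral_pow_clusterLaw {θ : ℝ} (h0 : 0 ≤ θ) (h1 : θ < 1) (k : ℕ) :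
    ∫ w, w ^ k ∂(clusterLaw θ) = ∑ γ ∈ levelPaths k, θ ^ depth γ := by
  have := isProbabilityMeasure_clusterLaw h0 h1
  have hint : Integrable (fun w : ℝ => w ^ k) (clusterLaw θ) := by
    refine Integrable.of_bound (by fun_prop) (2 ^ k) ?_
    filter_upwards [ae_abs_le_clusterLaw θ] with w hw
    rw [norm_pow, Real.norm_eq_abs]
    exact pow_le_pow_left₀ (abs_nonneg w) hw _
  have h2 := hasSum_integral_measure hint
  refine h2.unique ?_
  refine Eq.subst (motive := fun f => HasSum f _) (funext fun n => Eq.symm ?_)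
    (hasSum_trace h0 h1 k)
  rw [integral_smul_measure, integral_finsetSum_measure fun u _ => integrable_dirac (by simp),
    ENNReal.toReal_ofReal (by positivity), smul_eq_mul]
  simp only [integral_dirac]

theorem segmentEigenvalue_eq_zero_iff (n : ℕ) {u : ℕ} (hu : u < n + 1) :
    segmentEigenvalue (n + 2) u = 0 ↔ 2 * (u + 1) = n + 2 := by
  have hπ := Real.pi_pos
  have hn : (0 : ℝ) < (n + 2 : ℕ) := by positivity
  rw [segmentEigenvalue, mul_eq_zero_iff_left (by norm_num : (2 : ℝ) ≠ 0),
    ← Real.cos_pi_div_two]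
  have h1 : ((u + 1 : ℕ) : ℝ) * Real.pi / (n + 2 : ℕ) ∈ Set.Icc 0 Real.pi := by
    refine ⟨by positivity, ?_⟩
    rw [div_le_iff₀ hn, mul_comm Real.pi]
    refine mul_le_mul_of_nonneg_right ?_ hπ.le
    exact_mod_cast (by omega : u + 1 ≤ n + 2)
  rw [Real.injOn_cos.eq_iff h1 ⟨by positivity, by linarith⟩, div_eq_div_iff hn.ne' two_ne_zero]
  constructor
  · intro h
    have : ((2 * (u + 1) : ℕ) : ℝ) = (n + 2 : ℕ) := by
      push_cast at h ⊢
      nlinarith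
    exact_mod_cast this
  · intro h
    have : ((2 * (u + 1) : ℕ) : ℝ) = (n + 2 : ℕ) := by exact_mod_cast h
    push_cast at this ⊢
    rw [← this]
    ring

/-- A segment with n+1 vertices has the eigenvalue 0, once, exactly when n is even. The atom is
therefore (1-θ)² ∑ θ^(2r). -/
theorem clusterLaw_zero {θ : ℝ} (h0 : 0 ≤ θ) (h1 : θ < 1) :
    clusterLaw θ {0} = ENNReal.ofReal ((1 - θ) / (1 + θ)) := by
  rw [← lintegral_indicator_one (measurableSet_singleton (0 : ℝ)), lintegral_clusterLaw]
  have h2 : ∀ n : ℕ, ∑ u ∈ Finset.range (n + 1),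
      Set.indicator {(0 : ℝ)} (1 : ℝ → ℝ≥0∞) (segmentEigenvalue (n + 2) u) =
      if Even n then 1 else 0 := by
    intro n
    have h3 : ∀ u ∈ Finset.range (n + 1),
        Set.indicator {(0 : ℝ)} (1 : ℝ → ℝ≥0∞) (segmentEigenvalue (n + 2) u) =
        if 2 * (u + 1) = n + 2 then 1 else 0 := by
      intro u hu
      simp only [Set.indicator_apply, Set.mem_singleton_iff,
        segmentEigenvalue_eq_zero_iff n (Finset.mem_range.mp hu), Pi.one_apply]
    rw [Finset.sum_congr rfl h3]
    split_ifs with hn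
    · obtain ⟨r, hr⟩ := hn
      rw [Finset.sum_eq_single r]
      · rw [if_pos (by omega)]
      · intro u _ hu
        rw [if_neg (by omega)]
      · intro hr'
        rw [Finset.mem_range] at hr'
        omega
    · refine Finset.sum_eq_zero fun u _ => if_neg fun h => hn ⟨u, by omega⟩
  simp only [h2]
  have h4 : HasSum (fun n : ℕ => if Even n then (1 - θ) ^ 2 * θ ^ n else 0)
      ((1 - θ) / (1 + θ)) := by
    have hinj : Function.Injective fun n : ℕ => 2 * n := fun a b h => by simpa using h
    rw [← hinj.hasSum_iff]
    · have h5 : (fun n : ℕ => if Even n then (1 - θ) ^ 2 * θ ^ n else 0) ∘ (fun n : ℕ => 2 * n) =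
          fun n : ℕ => (1 - θ) ^ 2 * (θ ^ 2) ^ n := by
        funext n
        simp [pow_mul]
      rw [h5]
      have h6 := (hasSum_geometric_of_lt_one (sq_nonneg θ) (by nlinarith : θ ^ 2 < 1)).mul_left
        ((1 - θ) ^ 2)
      have h7 : 1 - θ ≠ 0 := by linarith
      have h8 : 1 + θ ≠ 0 := by linarith
      have h9 : (1 - θ) ^ 2 * (1 - θ ^ 2)⁻¹ = (1 - θ) / (1 + θ) := by
        rw [show 1 - θ ^ 2 = (1 - θ) * (1 + θ) by ring]
        field_simp
      rwa [h9] at h6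
    · intro n hn
      rw [if_neg]
      rintro ⟨r, hr⟩
      exact hn ⟨r, by simp only; omega⟩
  rw [← h4.tsum_eq, ENNReal.ofReal_tsum_of_nonneg _ h4.summable]
  · refine tsum_congr fun n => ?_
    split_ifs <;> simp
  · intro n
    split_ifs
    · positivity
    · exact le_rfl

/-! ### The density of the Bernoulli case -/

theorem measurable_g (α : ℝ) (M : ℕ) : Measurable (g α M) := by
  have h1 : Measurable fun n : ℕ => ∑ u ∈ Finset.Icc 1 n,
      1 / (α * (2 : ℝ) ^ (1 / α) * |Real.cos (u * Real.pi / M)| ^ (1 / α)) :=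
    measurable_from_nat
  have h2 : Measurable fun x : ℝ => ⌊(M : ℝ) * Real.arccos (|x| / 2) / Real.pi⌋₊ :=
    Nat.measurable_floor.comp (((Real.measurable_arccos.comp
      (measurable_id.abs.div_const 2)).const_mul _).div_const _)
  exact (measurable_id.abs.pow_const _).mul (h1.comp h2)

theorem g_nonneg {α : ℝ} (hα : 0 < α) (M : ℕ) (x : ℝ) : 0 ≤ g α M x :=
  mul_nonneg (Real.rpow_nonneg (abs_nonneg _) _)
    (Finset.sum_nonneg fun u _ => by positivity)

theorem sum_Icc_one_eq_sum_range {E : Type*} [AddCommMonoid E] (F : ℕ → E) (N : ℕ) :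
    ∑ u ∈ Finset.Icc 1 N, F u = ∑ u ∈ Finset.range N, F (u + 1) := by
  induction N with
  | zero => simp
  | succ N ih => rw [Finset.sum_Icc_succ_top (by omega), Finset.sum_range_succ, ih]

/-- The sum in g_M stops before M/2, so only positive cosines enter it. -/
theorem arccos_floor_lt {M : ℕ} (hM : 2 ≤ M) {x : ℝ} (hx : x ≠ 0) :
    2 * ⌊(M : ℝ) * Real.arccos (|x| / 2) / Real.pi⌋₊ < M := by
  have hπ := Real.pi_pos
  have h1 : Real.arccos (|x| / 2) < Real.pi / 2 := Real.arccos_lt_pi_div_two.mpr (by positivity)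
  have hM' : (0 : ℝ) < M := by exact_mod_cast (by omega : 0 < M)
  have h2 := Nat.floor_le (show 0 ≤ (M : ℝ) * Real.arccos (|x| / 2) / Real.pi from
    div_nonneg (mul_nonneg hM'.le (Real.arccos_nonneg _)) hπ.le)
  have h3 : (M : ℝ) * Real.arccos (|x| / 2) / Real.pi < M / 2 := by
    rw [div_lt_div_iff₀ hπ two_pos]
    nlinarith
  have : (2 * ⌊(M : ℝ) * Real.arccos (|x| / 2) / Real.pi⌋₊ : ℝ) < M := by linarith
  exact_mod_cast this

/-- The floor in g_M counts the eigenvalues that are at least |x|, because cos decreases on [0, π].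
-/
theorem le_floor_arccos_iff {M : ℕ} {x : ℝ} (hx : |x| ≤ 2) {u : ℕ} (hu : u ≠ 0) (huM : u < M) :
    u ≤ ⌊(M : ℝ) * Real.arccos (|x| / 2) / Real.pi⌋₊ ↔
      |x| ≤ 2 * Real.cos (u * Real.pi / M) := by
  have hπ := Real.pi_pos
  have hM' : (0 : ℝ) < M := by exact_mod_cast (by omega : 0 < M)
  have h1 : (u : ℝ) * Real.pi / M ∈ Set.Icc 0 Real.pi := by
    refine ⟨by positivity, ?_⟩
    rw [div_le_iff₀ hM', mul_comm Real.pi]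
    refine mul_le_mul_of_nonneg_right ?_ hπ.le
    exact_mod_cast huM.le
  have habs := abs_nonneg x
  rw [Nat.le_floor_iff' hu, le_div_iff₀ hπ, ← div_le_iff₀' hM',
    ← Real.strictAntiOn_cos.le_iff_ge ⟨Real.arccos_nonneg _, Real.arccos_le_pi _⟩ h1,
    Real.cos_arccos (by linarith) (by linarith), div_le_iff₀' two_pos]

theorem powerDensity_of_pos {α w x : ℝ} (hx : 0 < x) :
    powerDensity α w x = if x ≤ w then
      ENNReal.ofReal (1 / α * |x| ^ (1 / α - 1) * |w| ^ (-(1 / α))) else 0 := by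
  rw [powerDensity]
  congr 1
  rw [eq_iff_iff]
  constructor
  · rintro ⟨h1, h2⟩
    have hw : 0 < w := by
      by_contra h
      exact absurd h1 (not_lt.mpr (div_nonpos_of_nonneg_of_nonpos hx.le (not_lt.mp h)))
    exact (div_le_one hw).mp h2
  · intro h
    have hw := hx.trans_le h
    exact ⟨div_pos hx hw, (div_le_one hw).mpr h⟩

theorem sum_powerDensity_of_pos {α : ℝ} (hα : 0 < α) {M : ℕ} (hM : 2 ≤ M) {x : ℝ} (hx : 0 < x)
    (hx2 : x ≤ 2) :
    ∑ u ∈ Finset.range (M - 1), powerDensity α (segmentEigenvalue M u) x =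
      ENNReal.ofReal (g α M x) := by
  have hlt := arccos_floor_lt hM hx.ne'
  have habs : |x| = x := abs_of_pos hx
  rw [g, ENNReal.ofReal_mul (by positivity), ENNReal.ofReal_sum_of_nonneg fun u _ => by positivity,
    sum_Icc_one_eq_sum_range, Finset.mul_sum]
  symm
  set N := ⌊(M : ℝ) * Real.arccos (|x| / 2) / Real.pi⌋₊ with hN
  have hiff : ∀ u : ℕ, u < M - 1 → (x ≤ segmentEigenvalue M u ↔ u < N) := fun u hu => by
    have := le_floor_arccos_iff (M := M) (x := x) (by rw [habs]; exact hx2) (u := u + 1)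
      (by omega) (by omega)
    rw [← hN, habs, Nat.succ_le_iff] at this
    exact this.symm
  have hsub : Finset.range N ⊆ Finset.range (M - 1) := Finset.range_subset_range.mpr (by omega)
  rw [← Finset.sum_subset hsub]
  · refine Finset.sum_congr rfl fun u hu => ?_
    have hu' := Finset.mem_range.mp hu
    have hle := (hiff u (Finset.mem_range.mp (hsub hu))).mpr hu'
    rw [powerDensity_of_pos hx, if_pos hle, ← ENNReal.ofReal_mul (by positivity)]
    congr 1
    rw [segmentEigenvalue] at hle
    have hcos : 0 < Real.cos ((u + 1 : ℕ) * Real.pi / M) := by linarith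
    rw [segmentEigenvalue, abs_mul, abs_two, Real.mul_rpow zero_le_two (abs_nonneg _),
      Real.rpow_neg zero_le_two, Real.rpow_neg (abs_nonneg _)]
    have : 0 < |Real.cos ((u + 1 : ℕ) * Real.pi / M)| := abs_pos.mpr hcos.ne'
    field_simp
  · intro u hu hu'
    rw [powerDensity_of_pos hx, if_neg]
    rw [hiff u (Finset.mem_range.mp hu)]
    exact fun h => hu' (Finset.mem_range.mpr h)

/-- The spectrum of a segment is symmetric about 0: reversing the index negates the eigenvalues. -/
theorem sum_powerDensity_neg (α : ℝ) {M : ℕ} (hM : 2 ≤ M) (x : ℝ) :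
    ∑ u ∈ Finset.range (M - 1), powerDensity α (segmentEigenvalue M u) (-x) =
      ∑ u ∈ Finset.range (M - 1), powerDensity α (segmentEigenvalue M u) x := by
  have hM' : (M : ℝ) ≠ 0 := by
    have : M ≠ 0 := by omega
    exact_mod_cast this
  rw [← Finset.sum_range_reflect]
  refine Finset.sum_congr rfl fun u hu => ?_
  rw [Finset.mem_range] at hu
  have : segmentEigenvalue M (M - 1 - 1 - u) = -segmentEigenvalue M u := by
    rw [segmentEigenvalue, segmentEigenvalue, ← mul_neg, ← Real.cos_pi_sub]
    congr 2
    rw [show M - 1 - 1 - u + 1 = M - (u + 1) by omega, Nat.cast_sub (by omega)]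
    field_simp
  rw [this, powerDensity_neg]

theorem g_neg (α : ℝ) (M : ℕ) (x : ℝ) : g α M (-x) = g α M x := by
  simp only [g, abs_neg]

theorem sum_powerDensity {α : ℝ} (hα : 0 < α) {M : ℕ} (hM : 2 ≤ M) {x : ℝ} (hx : x ≠ 0)
    (hx2 : |x| ≤ 2) :
    ∑ u ∈ Finset.range (M - 1), powerDensity α (segmentEigenvalue M u) x =
      ENNReal.ofReal (g α M x) := by
  rcases hx.lt_or_gt with h | h
  · have h1 : 0 < -x := by linarith
    rw [abs_of_neg h] at hx2
    rw [← sum_powerDensity_neg α hM, sum_powerDensity_of_pos hα hM h1 hx2, g_neg]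
  · rw [abs_of_pos h] at hx2
    exact sum_powerDensity_of_pos hα hM h hx2

theorem powerDensity_eq_zero {α w x : ℝ} (hwx : |w| < |x|) : powerDensity α w x = 0 := by
  rw [powerDensity, if_neg]
  rintro ⟨h1, h2⟩
  have hw : 0 < |w| := by
    rw [abs_pos]
    rintro rfl
    simp at h1
  rw [← abs_of_pos h1, abs_div, div_le_one hw] at h2
  linarith

/-- Every cosine in the sum is at least |x|/2, and there are at most M of them. The bound is linear
in M, so the geometric weights make the series converge. -/
theorem g_le {α : ℝ} (hα : 0 < α) {M : ℕ} (hM : 2 ≤ M) {x : ℝ} (hx : x ≠ 0) (hx2 : |x| ≤ 2) :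
    g α M x ≤ M * (1 / α * |x| ^ (-1 : ℝ)) := by
  have hx' : 0 < |x| := abs_pos.mpr hx
  have hlt := arccos_floor_lt hM hx
  set N := ⌊(M : ℝ) * Real.arccos (|x| / 2) / Real.pi⌋₊ with hN
  have hterm : ∀ u ∈ Finset.Icc 1 N,
      1 / (α * (2 : ℝ) ^ (1 / α) * |Real.cos (u * Real.pi / M)| ^ (1 / α)) ≤
        1 / (α * |x| ^ (1 / α)) := by
    intro u hu
    rw [Finset.mem_Icc] at hu
    have h1 := (le_floor_arccos_iff (M := M) hx2 (u := u) (by omega) (by omega)).mp hu.2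
    refine one_div_le_one_div_of_le (by positivity) ?_
    rw [mul_assoc, ← Real.mul_rpow zero_le_two (abs_nonneg _)]
    refine mul_le_mul_of_nonneg_left (Real.rpow_le_rpow hx'.le ?_ (by positivity)) hα.le
    exact h1.trans (by gcongr; exact le_abs_self _)
  have hsum := Finset.sum_le_card_nsmul _ _ _ hterm
  rw [Nat.card_Icc, nsmul_eq_mul, Nat.add_sub_cancel] at hsum
  have hNM : (N : ℝ) ≤ M := by exact_mod_cast (by omega : N ≤ M)
  calc g α M x ≤ |x| ^ (1 / α - 1) * (N * (1 / (α * |x| ^ (1 / α)))) := by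
        rw [g]
        exact mul_le_mul_of_nonneg_left hsum (by positivity)
    _ ≤ |x| ^ (1 / α - 1) * (M * (1 / (α * |x| ^ (1 / α)))) := by gcongr
    _ = M * (1 / α * |x| ^ (-1 : ℝ)) := by
        rw [sub_eq_add_neg, Real.rpow_add hx']
        field_simp

theorem summable_g {θ α : ℝ} (hα : 0 < α) (h0 : 0 ≤ θ) (h1 : θ < 1) {x : ℝ} (hx : x ≠ 0)
    (hx2 : |x| ≤ 2) : Summable fun N : ℕ => θ ^ N * g α (N + 3) x := by
  have hθ : ‖θ‖ < 1 := by rwa [Real.norm_eq_abs, abs_of_nonneg h0]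
  have h2 := (summable_pow_mul_geometric_of_norm_lt_one 1 hθ).add
    ((summable_geometric_of_lt_one h0 h1).mul_left 3)
  refine Summable.of_nonneg_of_le (fun N => mul_nonneg (by positivity) (g_nonneg hα _ _))
    (fun N => ?_) (h2.mul_right (1 / α * |x| ^ (-1 : ℝ)))
  calc θ ^ N * g α (N + 3) x ≤ θ ^ N * ((N + 3 : ℕ) * (1 / α * |x| ^ (-1 : ℝ))) :=
        mul_le_mul_of_nonneg_left (g_le hα (by omega) hx hx2) (by positivity)
    _ = _ := by
        push_cast
        ring

/-- Also true for a divergent series, both sides being 0 by convention; measurability therefore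
needs no convergence. -/
theorem tsum_eq_toReal_tsum {f : ℕ → ℝ} (hf : ∀ n, 0 ≤ f n) :
    ∑' n, f n = (∑' n, ENNReal.ofReal (f n)).toReal := by
  rw [ENNReal.tsum_toReal_eq fun n => ENNReal.ofReal_ne_top]
  exact tsum_congr fun n => (ENNReal.toReal_ofReal (hf n)).symm

theorem measurable_bernoulliDensity {θ α : ℝ} (hα : 0 < α) (h0 : 0 ≤ θ) :
    Measurable (bernoulliDensity θ α) := by
  refine Measurable.indicator ?_ measurableSet_Ioo
  refine Measurable.const_mul ?_ _
  have h : ∀ x : ℝ, ∑' N : ℕ, θ ^ N * g α (N + 3) x =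
      (∑' N : ℕ, ENNReal.ofReal (θ ^ N * g α (N + 3) x)).toReal := fun x =>
    tsum_eq_toReal_tsum fun N => mul_nonneg (by positivity) (g_nonneg hα _ _)
  simp only [h]
  exact (Measurable.tsum fun N =>
    ((measurable_g α (N + 3)).const_mul _).ennreal_ofReal).ennreal_toReal

theorem bernoulliDensity_nonneg {θ α : ℝ} (hα : 0 < α) (h0 : 0 ≤ θ) (x : ℝ) :
    0 ≤ bernoulliDensity θ α x := by
  refine Set.indicator_nonneg (fun x _ => ?_) x
  refine mul_nonneg (by positivity) (tsum_nonneg fun N => ?_)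
  exact mul_nonneg (by positivity) (g_nonneg hα _ _)

theorem lintegral_powerDensity_clusterLaw {θ α : ℝ} (hα : 0 < α) (h0 : 0 ≤ θ) (h1 : θ < 1) :
    ∀ᵐ x, ∫⁻ w, powerDensity α w x ∂(clusterLaw θ) =
      ENNReal.ofReal (2 * θ / (1 + θ)) * ENNReal.ofReal (bernoulliDensity θ α x) := by
  have hne : ∀ a : ℝ, ∀ᵐ x : ℝ, x ≠ a := fun a => by
    rw [ae_iff]
    simp
  filter_upwards [hne 0, hne 2, hne (-2)] with x hx hx2 hx3
  rw [lintegral_clusterLaw]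
  by_cases hmem : x ∈ Set.Ioo (-2 : ℝ) 2
  · have habs : |x| ≤ 2 := (abs_lt.mpr hmem).le
    have hs := summable_g hα h0 h1 hx habs
    -- A single vertex has only the eigenvalue 0 and contributes no density; dropping n = 0 makes
    -- the series start at g_3 and frees a factor θ.
    have hg2 : ENNReal.ofReal (g α 2 x) = 0 := by
      rw [← sum_powerDensity hα le_rfl hx habs]
      have : segmentEigenvalue 2 0 = 0 := by simp [segmentEigenvalue]
      simp [this, powerDensity]
    have hterm : ∀ n : ℕ, ∑ u ∈ Finset.range (n + 1),
        powerDensity α (segmentEigenvalue (n + 2) u) x = ENNReal.ofReal (g α (n + 2) x) := fun n =>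
      sum_powerDensity hα (by omega) hx habs
    simp only [hterm]
    rw [tsum_eq_zero_add' ENNReal.summable, hg2, mul_zero, zero_add, bernoulliDensity,
      Set.indicator_of_mem hmem, ← ENNReal.ofReal_mul (by positivity), ← mul_assoc]
    have hc : 2 * θ / (1 + θ) * ((1 + θ) * (1 - θ) ^ 2 / 2) = (1 - θ) ^ 2 * θ := by
      field_simp
    rw [hc, ENNReal.ofReal_mul (by positivity), ENNReal.ofReal_tsum_of_nonneg _ hs,
      ← ENNReal.tsum_mul_left]
    · refine tsum_congr fun n => ?_
      rw [← ENNReal.ofReal_mul (by positivity), ← ENNReal.ofReal_mul (by positivity)]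
      congr 1
      ring_nf
    · exact fun N => mul_nonneg (by positivity) (g_nonneg hα _ _)
  · rw [bernoulliDensity, Set.indicator_of_notMem hmem, ENNReal.ofReal_zero, mul_zero,
      ENNReal.tsum_eq_zero]
    intro n
    rw [Finset.sum_eq_zero, mul_zero]
    intro u _
    refine powerDensity_eq_zero ((abs_segmentEigenvalue_le _ _).trans_lt ?_)
    by_contra h
    have h4 := abs_le.mp (not_lt.mp h)
    -- The points ±2 were discarded, so outside (-2, 2) one has |x| > 2, beyond every eigenvalue.
    exact hmem ⟨lt_of_le_of_ne h4.1 (Ne.symm hx3), lt_of_le_of_ne h4.2 hx2⟩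

theorem isProbDensity_bernoulliDensity {θ α : ℝ} (hα : 0 < α) (h0 : 0 < θ) (h1 : θ < 1) :
    IsProbDensity (bernoulliDensity θ α) := by
  have hmeas := measurable_bernoulliDensity hα h0.le
  refine ⟨hmeas, bernoulliDensity_nonneg hα h0.le, ?_⟩
  have := isProbabilityMeasure_clusterLaw h0.le h1
  have h2 := lintegral_lintegral_powerDensity hα (clusterLaw θ)
  have hpos : 0 < 2 * θ / (1 + θ) := by positivity
  rw [lintegral_congr_ae (lintegral_powerDensity_clusterLaw hα h0.le h1),
    lintegral_const_mul _ hmeas.ennreal_ofReal, clusterLaw_zero h0.le h1, ← ENNReal.ofReal_one,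
    ← ENNReal.ofReal_sub _ (div_nonneg (by linarith) (by linarith)),
    show 1 - (1 - θ) / (1 + θ) = 2 * θ / (1 + θ) by field_simp; ring] at h2
  have h3 : ENNReal.ofReal (2 * θ / (1 + θ)) ≠ 0 := by simpa using hpos
  have h4 := congrArg (fun y => (ENNReal.ofReal (2 * θ / (1 + θ)))⁻¹ * y) h2
  simp only [← mul_assoc, ENNReal.inv_mul_cancel h3 ENNReal.ofReal_ne_top, one_mul] at h4
  exact h4

theorem scaledLaw_clusterLaw {θ α : ℝ} (hα : 0 < α) (h0 : 0 < θ) (h1 : θ < 1) :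
    scaledLaw α (clusterLaw θ) = bernoulliLaw θ α := by
  have := isProbabilityMeasure_clusterLaw h0.le h1
  rw [scaledLaw_eq hα, bernoulliLaw, if_neg h0.ne', if_neg h1.ne, clusterLaw_zero h0.le h1,
    withDensity_congr_ae (lintegral_powerDensity_clusterLaw hα h0.le h1), densityMeasure,
    ← withDensity_smul _ (measurable_bernoulliDensity hα h0.le).ennreal_ofReal]
  rfl

theorem L_eq_of_bernoulli {θ : ℝ} (α : ℝ) {m : ℕ → ℝ} (hm0 : m 0 = 1)
    (hm : ∀ k : ℕ, 1 ≤ k → m (2 * k) = θ) (k : ℕ) :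
    L α m k = 1 / (α * k + 1) * ∑ γ ∈ levelPaths k, θ ^ depth γ := by
  rw [L_eq]
  congr 1
  exact Finset.sum_congr rfl fun γ hγ => prod_crossings_eq_pow_depth hγ hm0 hm

theorem hasMoments_bernoulliLaw {θ α : ℝ} (hα : 0 < α) (h0 : 0 < θ) (h1 : θ < 1) {m : ℕ → ℝ}
    (hm0 : m 0 = 1) (hm : ∀ k : ℕ, 1 ≤ k → m (2 * k) = θ) :
    HasMoments (bernoulliLaw θ α) (L α m) ∧ ∃ R, ∀ᵐ x ∂(bernoulliLaw θ α), |x| ≤ R := by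
  have := isProbabilityMeasure_clusterLaw h0.le h1
  rw [← scaledLaw_clusterLaw hα h0 h1]
  refine ⟨hasMoments_scaledLaw hα (ae_abs_le_clusterLaw θ) fun k => ?_, 2,
    ae_abs_le_scaledLaw hα (ae_abs_le_clusterLaw θ)⟩
  rw [L_eq_of_bernoulli α hm0 hm, integral_pow_clusterLaw h0.le h1]

/-- At θ = 0 only the single vertex survives in `hasSum_trace`, and the path sum is 0^k. -/
theorem hasMoments_bernoulliLaw_zero {α : ℝ} {m : ℕ → ℝ}
    (hm0 : m 0 = 1) (hm : ∀ k : ℕ, 1 ≤ k → m (2 * k) = 0) :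
    HasMoments (bernoulliLaw 0 α) (L α m) ∧ ∃ R, ∀ᵐ x ∂(bernoulliLaw 0 α), |x| ≤ R := by
  rw [bernoulliLaw, if_pos rfl]
  refine ⟨fun k => ⟨integrable_dirac (by simp), ?_⟩, 0, ?_⟩
  · have h2 := hasSum_trace le_rfl zero_lt_one k
    have h3 := hasSum_single (f := fun n : ℕ => (1 - (0 : ℝ)) ^ 2 * 0 ^ n *
      ∑ u ∈ Finset.range (n + 1), segmentEigenvalue (n + 2) u ^ k) 0 fun n hn => by simp [hn]
    have h4 : segmentEigenvalue 2 0 = 0 := by simp [segmentEigenvalue]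
    rw [integral_dirac, L_eq_of_bernoulli α hm0 hm, h2.unique h3]
    rcases Nat.eq_zero_or_pos k with rfl | hk
    · simp
    · simp [h4, hk.ne']
  · rw [ae_dirac_eq]
    simp

/-! ### The arcsine law -/

/-- The law of `2 cos φ` for `φ` uniform on `(0, π)`. -/
noncomputable def arcsineLaw : Measure ℝ :=
  (ENNReal.ofReal (1 / Real.pi) • volume.restrict (Set.Ioo 0 Real.pi)).map
    fun φ => 2 * Real.cos φ

theorem measurable_two_mul_cos : Measurable fun φ : ℝ => 2 * Real.cos φ := by
  fun_prop

instance : IsProbabilityMeasure arcsineLaw := by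
  have : IsProbabilityMeasure
      (ENNReal.ofReal (1 / Real.pi) • volume.restrict (Set.Ioo 0 Real.pi)) := by
    refine ⟨?_⟩
    rw [Measure.smul_apply, Measure.restrict_apply_univ, Real.volume_Ioo, sub_zero, smul_eq_mul,
      ← ENNReal.ofReal_mul (by positivity), one_div, inv_mul_cancel₀ Real.pi_ne_zero,
      ENNReal.ofReal_one]
  exact Measure.isProbabilityMeasure_map measurable_two_mul_cos.aemeasurable

theorem ae_abs_le_arcsineLaw : ∀ᵐ w ∂arcsineLaw, |w| ≤ 2 := by
  rw [arcsineLaw, ae_map_iff measurable_two_mul_cos.aemeasurable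
    (measurableSet_le (by fun_prop) measurable_const)]
  refine Filter.Eventually.of_forall fun φ => ?_
  rw [abs_mul, abs_two]
  have := Real.abs_cos_le_one φ
  linarith

theorem lintegral_arcsineLaw {F : ℝ → ℝ≥0∞} (hF : Measurable F) :
    ∫⁻ w, F w ∂arcsineLaw =
      ENNReal.ofReal (1 / Real.pi) * ∫⁻ φ in Set.Ioo 0 Real.pi, F (2 * Real.cos φ) := by
  rw [arcsineLaw, lintegral_map hF measurable_two_mul_cos, lintegral_smul_measure, smul_eq_mul]

theorem arcsineLaw_zero : arcsineLaw {0} = 0 := by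
  rw [arcsineLaw, Measure.map_apply measurable_two_mul_cos (measurableSet_singleton 0),
    Measure.smul_apply, Measure.restrict_apply (measurable_two_mul_cos (measurableSet_singleton 0))]
  have hsub : (fun φ : ℝ => 2 * Real.cos φ) ⁻¹' {0} ∩ Set.Ioo 0 Real.pi ⊆ {Real.pi / 2} := by
    rintro φ ⟨h1, h2⟩
    have hπ := Real.pi_pos
    have h3 : Real.cos φ = Real.cos (Real.pi / 2) := by
      rw [Real.cos_pi_div_two]
      simpa using h1
    exact Real.injOn_cos ⟨h2.1.le, h2.2.le⟩ ⟨by positivity, by linarith⟩ h3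
  rw [measure_mono_null hsub (by simp), smul_zero]

theorem integral_cos_int_mul (j : ℤ) :
    ∫ φ in (0 : ℝ)..Real.pi, Real.cos (j * φ) = if 0 = j then Real.pi else 0 := by
  split_ifs with hj
  · subst hj
    simp
  · have hj' : (j : ℝ) ≠ 0 := by exact_mod_cast Ne.symm hj
    rw [intervalIntegral.integral_comp_mul_left _ hj', integral_cos, Real.sin_int_mul_pi]
    simp

/-- The identity cos((j-1)φ) + cos((j+1)φ) = 2 cos φ cos(jφ) is the path recursion under the
integral; the case k = 0 is orthogonality of cosines. -/
theorem pathSum_one_eq_integral (k : ℕ) (j : ℤ) :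
    pathSum (fun _ _ => (1 : ℝ)) k 0 j =
      1 / Real.pi * ∫ φ in (0 : ℝ)..Real.pi, Real.cos (j * φ) * (2 * Real.cos φ) ^ k := by
  have hπ := Real.pi_ne_zero
  induction k generalizing j with
  | zero =>
    simp only [pow_zero, mul_one, pathSum_zero, integral_cos_int_mul]
    split_ifs
    · field_simp
    · simp
  | succ k ih =>
    have hint : ∀ j : ℤ, IntervalIntegrable
        (fun φ : ℝ => Real.cos (j * φ) * (2 * Real.cos φ) ^ k) volume 0 Real.pi := fun j =>
      Continuous.intervalIntegrable (by fun_prop) _ _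
    rw [pathSum_succ, ih, ih, mul_one, mul_one, ← mul_add,
      ← intervalIntegral.integral_add (hint _) (hint _)]
    congr 1
    refine intervalIntegral.integral_congr fun φ _ => ?_
    have h : Real.cos (((j - 1 : ℤ) : ℝ) * φ) + Real.cos (((j + 1 : ℤ) : ℝ) * φ) =
        2 * Real.cos φ * Real.cos (j * φ) := by
      push_cast
      rw [sub_mul, add_mul, one_mul, Real.cos_sub, Real.cos_add]
      ring
    rw [← add_mul, h]
    ring

theorem integral_pow_arcsineLaw (k : ℕ) :
    ∫ w, w ^ k ∂arcsineLaw = ∑ γ ∈ levelPaths k, (1 : ℝ) ^ depth γ := by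
  have h := pathSum_one_eq_integral k 0
  simp only [pathSum, Finset.prod_const_one, Int.cast_zero, zero_mul, Real.cos_zero, one_mul] at h
  rw [sum_paths_eq_sum_levelPaths k (fun _ => (1 : ℝ)) fun _ _ => rfl] at h
  simp only [one_pow]
  rw [h, arcsineLaw, integral_map measurable_two_mul_cos.aemeasurable (by fun_prop),
    integral_smul_measure, ENNReal.toReal_ofReal (by positivity), smul_eq_mul,
    intervalIntegral.integral_of_le Real.pi_pos.le, integral_Ioc_eq_integral_Ioo]

/-! ### Ullman's density -/

/-- The integral that defines Ullman's density, without its normalization. -/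
noncomputable def ullmanIntegral (α x : ℝ) : ℝ≥0∞ :=
  ∫⁻ t in Set.Ioc (|x| / 2) 1, ENNReal.ofReal (t ^ (-1 + 1 / α) / Real.sqrt (4 * t ^ 2 - x ^ 2))

/-- The domain of integration depends on x; an indicator on the plane makes the integral a section
integral of one measurable function. -/
theorem measurable_ullmanIntegral (α : ℝ) : Measurable (ullmanIntegral α) := by
  have hs : MeasurableSet {p : ℝ × ℝ | |p.1| / 2 < p.2 ∧ p.2 ≤ 1} :=
    (measurableSet_lt (f := fun p : ℝ × ℝ => |p.1| / 2) (by fun_prop) measurable_snd).inter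
      (measurableSet_le measurable_snd measurable_const)
  have hm : Measurable fun p : ℝ × ℝ =>
      ENNReal.ofReal (p.2 ^ (-1 + 1 / α) / Real.sqrt (4 * p.2 ^ 2 - p.1 ^ 2)) := by
    fun_prop
  have h := (hm.indicator hs).lintegral_prod_right' (ν := volume)
  refine Eq.subst (motive := Measurable) (funext fun x => ?_) h
  rw [ullmanIntegral, ← lintegral_indicator measurableSet_Ioc]
  refine lintegral_congr fun t => ?_
  by_cases ht : |x| / 2 < t ∧ t ≤ 1
  · rw [Set.indicator_of_mem (by exact ht), Set.indicator_of_mem (by exact ht)]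
  · rw [Set.indicator_of_notMem (by exact ht), Set.indicator_of_notMem (by exact ht)]

theorem ullmanDensity_eq (α : ℝ) :
    ullmanDensity α = Set.indicator (Set.Icc (-2) 2)
      fun x => 1 / (α * Real.pi) * (ullmanIntegral α x).toReal := by
  funext x
  rw [ullmanDensity]
  by_cases hx : x ∈ Set.Icc (-2 : ℝ) 2
  · rw [Set.indicator_of_mem hx, Set.indicator_of_mem hx]
    have habs : |x| ≤ 2 := abs_le.mpr hx
    rw [intervalIntegral.integral_of_le (by linarith), ullmanIntegral,
      integral_eq_lintegral_of_nonneg_ae]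
    · filter_upwards [ae_restrict_mem measurableSet_Ioc] with t ht
      have h0 : 0 ≤ t := (div_nonneg (abs_nonneg x) zero_le_two).trans ht.1.le
      exact div_nonneg (Real.rpow_nonneg h0 _) (Real.sqrt_nonneg _)
    · exact Measurable.aestronglyMeasurable (by fun_prop)
  · rw [Set.indicator_of_notMem hx, Set.indicator_of_notMem hx]

theorem measurable_ullmanDensity (α : ℝ) : Measurable (ullmanDensity α) := by
  rw [ullmanDensity_eq]
  exact ((measurable_ullmanIntegral α).ennreal_toReal.const_mul _).indicator measurableSet_Icc

theorem ullmanDensity_nonneg {α : ℝ} (hα : 0 < α) (x : ℝ) : 0 ≤ ullmanDensity α x := by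
  rw [ullmanDensity_eq]
  exact Set.indicator_nonneg (fun x _ => by positivity) x

/-- Substitute φ = arccos(x/(2t)), that is x = 2t cos φ: the condition x ≤ 2cos φ becomes x/2 < t ≤
1 up to an endpoint, and the derivative produces the square root. -/
theorem lintegral_powerDensity_cos {α : ℝ} (hα : 0 < α) {x : ℝ} (hx : 0 < x) (hx2 : x ≤ 2) :
    ∫⁻ φ in Set.Ioo 0 Real.pi, powerDensity α (2 * Real.cos φ) x =
      ENNReal.ofReal (1 / α) * ullmanIntegral α x := by
  have hπ := Real.pi_pos
  set s : Set ℝ := Set.Ioc (x / 2) 1 with hs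
  set f : ℝ → ℝ := fun t => Real.arccos (x / (2 * t)) with hf
  have hs0 : ∀ t ∈ s, 0 < t := fun t ht => (by positivity : 0 < x / 2).trans ht.1
  have hs1 : ∀ t ∈ s, 0 < x / (2 * t) ∧ x / (2 * t) < 1 := fun t ht => by
    have h0 := hs0 t ht
    refine ⟨by positivity, ?_⟩
    rw [div_lt_one (by positivity)]
    have := ht.1
    linarith
  have hinj : Set.InjOn f s := by
    intro t ht u hu h
    have h1 := hs1 t ht
    have h2 := hs1 u hu
    have h3 := Real.arccos_injOn ⟨by linarith, h1.2.le⟩ ⟨by linarith, h2.2.le⟩ h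
    have h4 := hs0 t ht
    have h5 := hs0 u hu
    field_simp at h3
    exact h3.symm
  have himg : f '' s = Set.Ioc 0 (Real.arccos (x / 2)) := by
    ext φ
    constructor
    · rintro ⟨t, ht, rfl⟩
      have h1 := hs1 t ht
      have h0 := hs0 t ht
      refine ⟨Real.arccos_pos.mpr h1.2, Real.antitone_arccos ?_⟩
      refine div_le_div_of_nonneg_left hx.le (by positivity) ?_
      have := ht.2
      linarith
    · rintro ⟨h0, h1⟩
      have h2 : φ < Real.pi / 2 := h1.trans_lt (Real.arccos_lt_pi_div_two.mpr (by positivity))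
      have hc : 0 < Real.cos φ := Real.cos_pos_of_mem_Ioo ⟨by linarith, h2⟩
      have hc1 : Real.cos φ < 1 := by
        rw [← Real.cos_zero]
        exact Real.strictAntiOn_cos ⟨le_rfl, hπ.le⟩ ⟨h0.le, by linarith⟩ h0
      have hc2 : x / 2 ≤ Real.cos φ := by
        rw [← Real.cos_arccos (x := x / 2) (by linarith) (by linarith)]
        exact Real.strictAntiOn_cos.antitoneOn ⟨h0.le, by linarith⟩
          ⟨Real.arccos_nonneg _, Real.arccos_le_pi _⟩ h1
      refine ⟨x / (2 * Real.cos φ), ⟨?_, ?_⟩, ?_⟩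
      · exact div_lt_div_of_pos_left hx (by positivity) (by linarith)
      · rw [div_le_one (by positivity)]
        linarith
      · simp only [hf]
        rw [show x / (2 * (x / (2 * Real.cos φ))) = Real.cos φ by field_simp,
          Real.arccos_cos h0.le (by linarith)]
  have hder : ∀ t ∈ s, HasDerivWithinAt f
      (x / (2 * t ^ 2) / Real.sqrt (1 - (x / (2 * t)) ^ 2)) s t := by
    intro t ht
    have h0 := hs0 t ht
    have h1 := hs1 t ht
    have h2 : HasDerivAt (fun t : ℝ => x / (2 * t)) (-(x / (2 * t ^ 2))) t := by
      have h3 := (hasDerivAt_inv h0.ne').const_mul (x / 2)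
      have h4 : (fun t : ℝ => x / (2 * t)) = fun t => x / 2 * t⁻¹ := by
        funext t
        rw [← div_div, div_eq_mul_inv (x / 2)]
      rw [h4]
      refine h3.congr_deriv ?_
      field_simp
    have h5 := (Real.hasDerivAt_arccos (x := x / (2 * t)) (by linarith) h1.2.ne).comp t h2
    refine HasDerivWithinAt.congr_deriv h5.hasDerivWithinAt ?_
    ring
  have hset : ∀ φ ∈ Set.Ioo 0 Real.pi, (x ≤ 2 * Real.cos φ ↔ φ ≤ Real.arccos (x / 2)) := by
    intro φ hφ
    rw [← Real.strictAntiOn_cos.le_iff_ge ⟨Real.arccos_nonneg _, Real.arccos_le_pi _⟩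
      ⟨hφ.1.le, hφ.2.le⟩, Real.cos_arccos (by linarith) (by linarith), div_le_iff₀' two_pos]
  have hlt : Real.arccos (x / 2) < Real.pi / 2 := Real.arccos_lt_pi_div_two.mpr (by positivity)
  have h1 : ∫⁻ φ in Set.Ioo 0 Real.pi, powerDensity α (2 * Real.cos φ) x =
      ∫⁻ φ in Set.Ioc 0 (Real.arccos (x / 2)),
        ENNReal.ofReal (1 / α * |x| ^ (1 / α - 1) * |2 * Real.cos φ| ^ (-(1 / α))) := by
    rw [← lintegral_indicator measurableSet_Ioo, ← lintegral_indicator measurableSet_Ioc]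
    refine lintegral_congr fun φ => ?_
    by_cases hφ : φ ∈ Set.Ioo 0 Real.pi
    · rw [Set.indicator_of_mem hφ, powerDensity_of_pos hx, Set.indicator_apply]
      by_cases h : x ≤ 2 * Real.cos φ
      · rw [if_pos h, if_pos ⟨hφ.1, (hset φ hφ).mp h⟩]
      · rw [if_neg h, if_neg fun h' => h ((hset φ hφ).mpr h'.2)]
    · rw [Set.indicator_of_notMem hφ, Set.indicator_of_notMem]
      exact fun h => hφ ⟨h.1, h.2.trans_lt (by linarith)⟩
  rw [h1, ← himg, lintegral_image_eq_lintegral_abs_deriv_mul measurableSet_Ioc hder hinj,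
    ullmanIntegral, abs_of_pos hx, ← lintegral_const_mul' _ _ ENNReal.ofReal_ne_top]
  refine setLIntegral_congr_fun measurableSet_Ioc fun t ht => ?_
  have ht0 := hs0 t ht
  have ht1 := hs1 t ht
  simp only [hf]
  rw [Real.cos_arccos (by linarith) ht1.2.le, ← ENNReal.ofReal_mul (abs_nonneg _),
    ← ENNReal.ofReal_mul (by positivity)]
  congr 1
  have hpos : 0 < 4 * t ^ 2 - x ^ 2 := by
    have := ht.1
    nlinarith
  have hsq : Real.sqrt (1 - (x / (2 * t)) ^ 2) = Real.sqrt (4 * t ^ 2 - x ^ 2) / (2 * t) := by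
    rw [show 1 - (x / (2 * t)) ^ 2 = (4 * t ^ 2 - x ^ 2) / (2 * t) ^ 2 by field_simp; ring,
      Real.sqrt_div hpos.le, Real.sqrt_sq (by positivity)]
  have hsqp : 0 < Real.sqrt (4 * t ^ 2 - x ^ 2) := Real.sqrt_pos.mpr hpos
  rw [hsq, show 2 * (x / (2 * t)) = x / t by field_simp, abs_of_pos (by positivity),
    abs_of_pos (by positivity : 0 < x / t), Real.div_rpow hx.le ht0.le, Real.rpow_sub hx,
    Real.rpow_one, Real.rpow_neg hx.le, Real.rpow_neg ht0.le, Real.rpow_add ht0,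
    Real.rpow_neg_one]
  have h3 : 0 < x ^ (1 / α) := Real.rpow_pos_of_pos hx _
  have h4 : 0 < t ^ (1 / α) := Real.rpow_pos_of_pos ht0 _
  -- Once the exponents are split, the two real powers are mere positive constants and the identity
  -- is rational.
  generalize x ^ (1 / α) = a at *
  generalize t ^ (1 / α) = b at *
  field_simp

theorem lintegral_powerDensity_cos_neg (α x : ℝ) :
    ∫⁻ φ in Set.Ioo 0 Real.pi, powerDensity α (2 * Real.cos φ) (-x) =
      ∫⁻ φ in Set.Ioo 0 Real.pi, powerDensity α (2 * Real.cos φ) x := by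
  rw [← lintegral_indicator measurableSet_Ioo, ← lintegral_indicator measurableSet_Ioo,
    ← lintegral_sub_left_eq_self _ Real.pi]
  refine lintegral_congr fun φ => ?_
  by_cases hφ : φ ∈ Set.Ioo 0 Real.pi
  · have h : Real.pi - φ ∈ Set.Ioo 0 Real.pi := ⟨by linarith [hφ.2], by linarith [hφ.1]⟩
    rw [Set.indicator_of_mem hφ, Set.indicator_of_mem h, Real.cos_pi_sub, mul_neg,
      powerDensity_neg]
  · have h : Real.pi - φ ∉ Set.Ioo 0 Real.pi := fun h =>
      hφ ⟨by linarith [h.2], by linarith [h.1]⟩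
    rw [Set.indicator_of_notMem hφ, Set.indicator_of_notMem h]

theorem lintegral_powerDensity_arcsineLaw {α : ℝ} (hα : 0 < α) :
    ∀ᵐ x, ∫⁻ w, powerDensity α w x ∂arcsineLaw = ENNReal.ofReal (ullmanDensity α x) := by
  have hne : ∀ᵐ x : ℝ, x ≠ 0 := by
    rw [ae_iff]
    simp
  -- Finite total mass gives finiteness almost everywhere; without it the passage to the real-valued
  -- integral in Ullman's density would lose an infinite value.
  have hfin : ∀ᵐ x, ∫⁻ w, powerDensity α w x ∂arcsineLaw < ∞ := by
    refine ae_lt_top (measurable_lintegral_powerDensity α arcsineLaw) ?_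
    rw [lintegral_lintegral_powerDensity hα]
    exact ENNReal.sub_ne_top ENNReal.one_ne_top
  have hα' : 0 < 1 / α := by positivity
  have hπ' : 0 < 1 / Real.pi := by positivity
  filter_upwards [hne, hfin] with x hx hxfin
  rw [ullmanDensity_eq]
  by_cases hmem : x ∈ Set.Icc (-2 : ℝ) 2
  · have hmeas : Measurable fun w => powerDensity α w x :=
      (measurable_powerDensity α).comp measurable_prodMk_right
    have key : ∫⁻ φ in Set.Ioo 0 Real.pi, powerDensity α (2 * Real.cos φ) x =
        ENNReal.ofReal (1 / α) * ullmanIntegral α x := by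
      rcases hx.lt_or_gt with h | h
      · have h1 := lintegral_powerDensity_cos hα (x := -x) (by linarith) (by linarith [hmem.1])
        rw [lintegral_powerDensity_cos_neg] at h1
        rw [h1]
        simp only [ullmanIntegral, abs_neg, neg_sq]
      · exact lintegral_powerDensity_cos hα h hmem.2
    rw [lintegral_arcsineLaw hmeas, key] at hxfin ⊢
    have hU : ullmanIntegral α x ≠ ∞ := by
      intro h
      rw [h, ENNReal.mul_top (by simpa using hα),
        ENNReal.mul_top (by simpa using Real.pi_pos)] at hxfin
      exact lt_irrefl _ hxfin
    rw [Set.indicator_of_mem hmem, ENNReal.ofReal_mul (by positivity), ENNReal.ofReal_toReal hU,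
      ← mul_assoc, ← ENNReal.ofReal_mul hπ'.le]
    congr 2
    field_simp
  · rw [Set.indicator_of_notMem hmem, ENNReal.ofReal_zero]
    have h2 : 2 < |x| := by
      by_contra h
      exact hmem (abs_le.mp (not_lt.mp h))
    rw [lintegral_congr_ae (g := fun _ => 0), lintegral_zero]
    filter_upwards [ae_abs_le_arcsineLaw] with w hw
    exact powerDensity_eq_zero (hw.trans_lt h2)

theorem isProbDensity_ullmanDensity {α : ℝ} (hα : 0 < α) : IsProbDensity (ullmanDensity α) := by
  refine ⟨measurable_ullmanDensity α, ullmanDensity_nonneg hα, ?_⟩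
  rw [← lintegral_congr_ae (lintegral_powerDensity_arcsineLaw hα),
    lintegral_lintegral_powerDensity hα, arcsineLaw_zero, tsub_zero]

theorem scaledLaw_arcsineLaw {α : ℝ} (hα : 0 < α) :
    scaledLaw α arcsineLaw = bernoulliLaw 1 α := by
  rw [scaledLaw_eq hα, bernoulliLaw, if_neg one_ne_zero, if_pos rfl, arcsineLaw_zero, zero_smul,
    add_zero, withDensity_congr_ae (lintegral_powerDensity_arcsineLaw hα), densityMeasure]

theorem hasMoments_bernoulliLaw_one {α : ℝ} (hα : 0 < α) {m : ℕ → ℝ}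
    (hm0 : m 0 = 1) (hm : ∀ k : ℕ, 1 ≤ k → m (2 * k) = 1) :
    HasMoments (bernoulliLaw 1 α) (L α m) ∧ ∃ R, ∀ᵐ x ∂(bernoulliLaw 1 α), |x| ≤ R := by
  rw [← scaledLaw_arcsineLaw hα]
  refine ⟨hasMoments_scaledLaw hα ae_abs_le_arcsineLaw fun k => ?_, 2,
    ae_abs_le_scaledLaw hα ae_abs_le_arcsineLaw⟩
  rw [L_eq_of_bernoulli α hm0 hm, integral_pow_arcsineLaw]

end TridiagonalMoments

/-! ### The main theorem -/

theorem proposition3 (α : ℝ) (hα : 0 < α) (m : ℕ → ℝ) :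
    (∀ (Ω : Type*) [MeasurableSpace Ω] (P : Measure Ω) [IsProbabilityMeasure P]
        (μ : Measure ℝ) [IsProbabilityMeasure μ] (Y : Ω → ℝ),
        HasLaw Y μ P → TridiagonalMoments.IsBoundedRV P Y →
        (∀ k : ℕ, ∫ ω, Y ω ^ (2 * k) ∂P = m (2 * k)) →
        ∃ (A : TridiagonalMoments.JacobiSpace μ →L[ℂ] TridiagonalMoments.JacobiSpace μ)
          (ϖ : Measure ℝ),
          TridiagonalMoments.IsRandomJacobi μ A ∧
          TridiagonalMoments.IsSpectralMeasureAt A (TridiagonalMoments.jacobiVector μ) ϖ ∧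
          ∃ (Ω' : Type) (_ : MeasurableSpace Ω') (P' : Measure Ω') (_ : IsProbabilityMeasure P')
            (T W Z : Ω' → ℝ),
            HasLaw T (volume.restrict (Set.Icc 0 1)) P' ∧ HasLaw W ϖ P' ∧ IndepFun T W P' ∧
            Z = (fun ω => T ω ^ α * W ω) ∧
            TridiagonalMoments.IsBoundedRV P' Z ∧
            TridiagonalMoments.HasMoments (P'.map Z) (TridiagonalMoments.L α m) ∧
            (∀ ν : Measure ℝ, TridiagonalMoments.HasMoments ν (TridiagonalMoments.L α m) →
              ν = P'.map Z) ∧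
            ∃ (τ : ℝ) (f : ℝ → ℝ), 0 ≤ τ ∧ τ ≤ 1 ∧ TridiagonalMoments.IsProbDensity f ∧
              P'.map Z = TridiagonalMoments.mixture τ f) ∧
    (∀ θ : ℝ, 0 ≤ θ → θ ≤ 1 → m 0 = 1 → (∀ k : ℕ, 1 ≤ k → m (2 * k) = θ) →
        TridiagonalMoments.HasMoments (TridiagonalMoments.bernoulliLaw θ α)
          (TridiagonalMoments.L α m) ∧
        (∀ ν : Measure ℝ, TridiagonalMoments.HasMoments ν (TridiagonalMoments.L α m) →
          ν = TridiagonalMoments.bernoulliLaw θ α) ∧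
        (θ = 1 → TridiagonalMoments.IsProbDensity (TridiagonalMoments.ullmanDensity α)) ∧
        (0 < θ → θ < 1 →
          TridiagonalMoments.IsProbDensity (TridiagonalMoments.bernoulliDensity θ α) ∧
          ∀ x : ℝ, x ∈ Set.Ioo (-2 : ℝ) 2 → x ≠ 0 →
            Summable fun N : ℕ => θ ^ N * TridiagonalMoments.g α (N + 3) x)) := by
  refine ⟨?_, fun θ h0 h1 hm0 hm => ?_⟩
  · intro Ω _ P _ μ _ Y hY hbdd hmom
    obtain ⟨-, C, hC⟩ := hbdd
    refine TridiagonalMoments.exists_jacobi_representation hα (C := C) ?_ fun k => ?_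
    · rw [← hY.map_eq, ae_map_iff hY.aemeasurable
        (measurableSet_le (f := fun y : ℝ => |y|) (by fun_prop) measurable_const)]
      exact hC
    · rw [← hmom k]
      exact (hY.integral_comp (f := fun y : ℝ => y ^ (2 * k))
        (continuous_pow _).aestronglyMeasurable).symm
  · have key : TridiagonalMoments.HasMoments (TridiagonalMoments.bernoulliLaw θ α)
        (TridiagonalMoments.L α m) ∧
        ∃ R, ∀ᵐ x ∂(TridiagonalMoments.bernoulliLaw θ α), |x| ≤ R := by
      rcases h0.eq_or_lt with rfl | hpos
      · exact TridiagonalMoments.hasMoments_bernoulliLaw_zero hm0 hm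
      · rcases h1.eq_or_lt with rfl | hlt
        · exact TridiagonalMoments.hasMoments_bernoulliLaw_one hα hm0 hm
        · exact TridiagonalMoments.hasMoments_bernoulliLaw hα hpos hlt hm0 hm
    obtain ⟨hmom, R, hR⟩ := key
    refine ⟨hmom, fun ν hν => hmom.eq_of_bounded hR hν,
      fun _ => TridiagonalMoments.isProbDensity_ullmanDensity hα, fun hpos hlt =>
      ⟨TridiagonalMoments.isProbDensity_bernoulliDensity hα hpos hlt, fun x hx hx0 =>
        TridiagonalMoments.summable_g hα h0 hlt hx0 (abs_lt.mpr hx).le⟩⟩
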